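/- Let $P\subset\mathbb{R}^d$ be a set of $n$ points, let $\varepsilon\in(0,\tfrac15]$, and let $I=\{(1+\varepsilon)^m : m\in\mathbb{Z}\}$ be the set of scales. **WSPD.** An $\frac{\varepsilon}{8}$-WSPD $W$ of $P$ is a finite set of pairs $(A,B)$ of non-empty subsets of $P$ with $\mathrm{diam}(A),\mathrm{diam}(B)\le\frac{\varepsilon}{8}\min_{p\in A,q\in B}\|p-q\|$, such that for any two distinct $p,q\in P$ some $(A,B)\in W$ has $p\in A,q\in B$ or $p\in B,q\in A$. For each pair choose representatives $rep_A\in A$, $rep_B\in B$ and put $d(A,B)=\|rep_A-rep_B\|$. Let $R_{(A,B)}$ be the interval $[d(A,B)/8,\,8d(A,B)]$ enlarged by the smallest amount such that its endpoints lie in $I$ (the interval stays $\{0\}$ if $d(A,B)=0$). For $p\in P$ let $R_p$ be the union of all $R_{(A,B)}$ for which $p=rep_A$ or $p=rep_B$, and let $r_p(\alpha)=\max\{r\le\alpha : r\in R_p\}$ ($0$ if there is no such $r$). A point $p$ is active at scale $\alpha$ if $r_p(\alpha)=\alpha$. **Tower.** For a scale $\alpha$ let $\beta$ be the largest power of $2$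 (with integer exponent) that is at most $\alpha$. The pixels at scale $\alpha$ are the closed cells of the cubical grid $\frac{\varepsilon\beta}{4\sqrt d}\,\mathbb{Z}^d$. Let $\mathcal{LS}'_\alpha$ be the set of pixels at scale $\alpha$ whose center lies in the ball of radius $(1+\varepsilon/2)\,r_p(\alpha)$ around some $p\in P$ that is active at scale $\alpha$. Fix a minimal scale $\alpha_0\in I$; let $\mathcal{LS}_{\alpha_0}$ consist of the points of $P$ (as degenerate pixels), and for $\alpha>\alpha_0$ in $I$ let $\mathcal{LS}_\alpha$ be the set of inclusion-maximal elements of $\mathcal{LS}_{\alpha/(1+\varepsilon)}\cup\mathcal{LS}'_\alpha$. Let $\mathcal{LX}_\alpha=\mathrm{nerve}(\mathcal{LS}_\alpha)$, connected by the simplicial maps $\mathcal{LX}_\alpha\to\mathcal{LX}_{(1+\varepsilon)\alpha}$ that map an element of $\mathcal{LS}_\alpha$ to an element of $\mathcal{LS}_{(1+\varepsilon)\alpha}$ containing it (for pixels it is unique; for a point of $P$ any choice is allowed). The size of the $k$-skeleton of this tower is the total number, over all scales, of simplices of dimension at most $k$ of $\mathcal{LX}_\alpha$ that are not in the image of the complex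 at the preceding scale (at $\alpha_0$ all simplices count). **Theorem.** There is an $\frac{\varepsilon}{8}$-WSPD of $P$ with at most $n\left(\frac1\varepsilon\right)^{O(d)}$ pairs, and, if the tower is constructed from any $\frac{\varepsilon}{8}$-WSPD with $n\left(\frac1\varepsilon\right)^{O(d)}$ pairs, then for every $k\ge0$ the size of the $k$-skeleton of the tower $(\mathcal{LX}_\alpha)$ is finite and at most $$n\left(\frac1\varepsilon\right)^{O(d)}2^{O(d\log d+dk)}.$$ Precisely: there is a constant $c_0\in\mathbb{N}$ such that for all $d$, $P$, $\varepsilon$ an $\frac{\varepsilon}{8}$-WSPD with at most $n(1/\varepsilon)^{c_0d}$ pairs exists; and for every $c\in\mathbb{N}$ there is a constant $C\in\mathbb{N}$ such that for all $d$, $k$, $P$, $\varepsilon$, every $\frac{\varepsilon}{8}$-WSPD with at most $n(1/\varepsilon)^{cd}$ pairs, all choices of representatives, every minimal scale $\alpha_0\in I$ and all admissible connecting maps, the size is at most $n(1/\varepsilon)^{Cd}\,2^{C(d\log_2 d+dk)}$ (with $0\log_2 0=0$). -/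

import Mathlib

open scoped Classical in
/-- A simplicial tower: a sequence of simplicial complexes on vertices of type `V`, with vertex maps
that induce simplicial maps between consecutive complexes. -/
structure SimplicialTower (V : Type*) where
  cpx : ℕ → PreAbstractSimplicialComplex V
  vmap : ℕ → V → V
  simplicial : ∀ i, (cpx i).map (vmap i) ≤ cpx (i + 1)

namespace SimplicialTower

variable {V : Type*}

/-- The `k`-skeleton of a complex: its simplices of dimension at most `k`. -/
def skeletonCpx (K : PreAbstractSimplicialComplex V) (k : ℕ) : PreAbstractSimplicialComplex V where
  faces := {σ | σ ∈ K ∧ σ.card ≤ k + 1}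
  isRelLowerSet_faces := by
    rintro σ ⟨hσ, hk⟩
    refine ⟨(K.isRelLowerSet_faces hσ).1, fun τ hτ hne => ⟨?_, ?_⟩⟩
    · exact (K.isRelLowerSet_faces hσ).2 hτ hne
    · exact (Finset.card_le_card hτ).trans hk

open scoped Classical in
/-- The `k`-skeleton of a tower, with the same vertex maps. -/
def skeleton (T : SimplicialTower V) (k : ℕ) : SimplicialTower V where
  cpx i := skeletonCpx (T.cpx i) k
  vmap := T.vmap
  simplicial := by
    rintro i σ ⟨τ, ⟨hτ, hk⟩, rfl⟩
    exact ⟨T.simplicial i ⟨τ, hτ, rfl⟩, Finset.card_image_le.trans hk⟩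

open scoped Classical in
/-- The simplices included in the tower at step `i`: those of the complex that are not in the image
of the preceding complex. At the first step all simplices are included. -/
def included (T : SimplicialTower V) : ℕ → Set (Finset V)
  | 0 => {σ | σ ∈ T.cpx 0}
  | i + 1 => {σ | σ ∈ T.cpx (i + 1) ∧ σ ∉ (T.cpx i).map (T.vmap i)}

/-- The size of a tower: the number of simplices included, over all steps. -/
noncomputable def size (T : SimplicialTower V) : ℕ∞ :=
  Set.encard {x : ℕ × Finset V | x.2 ∈ T.included x.1}

end SimplicialTower

/-- The nerve of a collection of sets: its simplices are the nonempty finite subcollections with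
a nonempty common intersection. -/
def nerveCpx {E : Type*} (S : Set (Set E)) : PreAbstractSimplicialComplex (Set E) where
  faces := {σ | σ.Nonempty ∧ (∀ C ∈ σ, C ∈ S) ∧ (⋂ C ∈ σ, C).Nonempty}
  isRelLowerSet_faces := by
    rintro σ ⟨hne, hS, x, hx⟩
    refine ⟨hne, fun τ hτ hτne => ⟨hτne, fun C hC => hS C (hτ hC), x, ?_⟩⟩
    simp only [Set.mem_iInter] at hx ⊢
    exact fun C hC => hx C (hτ hC)

namespace LazyCech

/-- `d`-dimensional Euclidean space. -/
abbrev Pt (d : ℕ) := EuclideanSpace ℝ (Fin d)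

variable {d : ℕ} {P : Finset (Pt d)} {δ : ℝ}

/-- A `δ`-well-separated pair decomposition of the point set `P`. -/
structure WSPD (P : Finset (Pt d)) (δ : ℝ) where
  pairs : Finset (Finset (Pt d) × Finset (Pt d))
  subset : ∀ w ∈ pairs, w.1 ⊆ P ∧ w.2 ⊆ P
  nonempty : ∀ w ∈ pairs, w.1.Nonempty ∧ w.2.Nonempty
  separated : ∀ w ∈ pairs, ∀ p ∈ w.1, ∀ q ∈ w.2,
    Metric.diam (w.1 : Set (Pt d)) ≤ δ * dist p q ∧ Metric.diam (w.2 : Set (Pt d)) ≤ δ * dist p q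
  covers : ∀ p ∈ P, ∀ q ∈ P, p ≠ q →
    ∃ w ∈ pairs, (p ∈ w.1 ∧ q ∈ w.2) ∨ (p ∈ w.2 ∧ q ∈ w.1)

/-- A choice of a representative of each of the two sides of every pair. -/
structure Reps (W : WSPD P δ) where
  left : Finset (Pt d) × Finset (Pt d) → Pt d
  right : Finset (Pt d) × Finset (Pt d) → Pt d
  left_mem : ∀ w ∈ W.pairs, left w ∈ w.1
  right_mem : ∀ w ∈ W.pairs, right w ∈ w.2

/-- The set `I` of scales: the integer powers of `1 + ε`. -/
def scales (ε : ℝ) : Set ℝ := {x | ∃ m : ℤ, x = (1 + ε) ^ m}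

/-- The interval `[a, b]`, `0 ≤ a ≤ b`, enlarged by the smallest amount such that its endpoints are
scales. An endpoint `0` stays where it is. -/
noncomputable def enlarged (ε a b : ℝ) : Set ℝ :=
  Set.Icc (sSup {x | x ∈ insert 0 (scales ε) ∧ x ≤ a}) (sInf {x | x ∈ insert 0 (scales ε) ∧ b ≤ x})

section construction

variable {W : WSPD P δ} (ε : ℝ) (rep : Reps W)

/-- The distance `d(A, B)` of the two representatives of a pair. -/
noncomputable def repDist (rep : Reps W) (w : Finset (Pt d) × Finset (Pt d)) : ℝ :=
  dist (rep.left w) (rep.right w)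

/-- The active interval `R_{(A,B)}` of a pair, `[d(A,B)/8, 8 d(A,B)]` with enlarged endpoints. -/
noncomputable def pairInterval (w : Finset (Pt d) × Finset (Pt d)) : Set ℝ :=
  enlarged ε (repDist rep w / 8) (8 * repDist rep w)

/-- The set `R_p` of active scales of the point `p`. -/
def activeScales (p : Pt d) : Set ℝ :=
  {α | ∃ w ∈ W.pairs, (p = rep.left w ∨ p = rep.right w) ∧ α ∈ pairInterval ε rep w}

/-- The radius `r_p(α) = max {r ≤ α | r ∈ R_p}` of the lazy ball at `p`. It is `0` (the value of
`sSup ∅`) as long as no active scale has been met. -/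
noncomputable def lazyRadius (p : Pt d) (α : ℝ) : ℝ :=
  sSup {r | r ∈ activeScales ε rep p ∧ r ≤ α}

/-- The side length `ε β / (4 √d)` of the grid used at scale `α > 0`, where `β` is the largest
power of `2` that is at most `α`. -/
noncomputable def gridSide (d : ℕ) (ε α : ℝ) : ℝ :=
  ε * (2 : ℝ) ^ (Int.log 2 α) / (4 * √(d : ℝ))

/-- The pixel (closed cube) of side length `s` with lowest corner `s • z`. -/
def pixel (s : ℝ) (z : Fin d → ℤ) : Set (Pt d) :=
  {x | ∀ i, s * z i ≤ x i ∧ x i ≤ s * (z i + 1)}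

/-- The center of `pixel s z`. -/
noncomputable def pixelCenter (s : ℝ) (z : Fin d → ℤ) : Pt d :=
  WithLp.toLp 2 fun i => s * (z i + 1 / 2)

/-- The collection `LS'_α`: the grid pixels whose center lies in the ball of radius
`(1 + ε/2) r_p(α)` around an active point `p`, that is, a point with `r_p(α) = α`. -/
def newPixels (α : ℝ) : Set (Set (Pt d)) :=
  {C | ∃ p ∈ P, lazyRadius ε rep p α = α ∧ ∃ z : Fin d → ℤ,
    dist (pixelCenter (gridSide d ε α) z) p ≤ (1 + ε / 2) * lazyRadius ε rep p α ∧
    C = pixel (gridSide d ε α) z}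

/-- The collections `LS_α` at the scales `α = (1 + ε) ^ (m₀ + i)`, `i = 0, 1, 2, …`, where
`(1 + ε) ^ m₀` is the minimal scale: at that scale it consists of the points of `P` as
degenerate pixels, and then of the inclusion-maximal elements of the preceding collection together
with the new pixels. -/
def lazyPixels (m₀ : ℤ) : ℕ → Set (Set (Pt d))
  | 0 => {C | ∃ p ∈ P, C = {p}}
  | i + 1 => {C | Maximal
      (fun D => D ∈ lazyPixels m₀ i ∪ newPixels ε rep ((1 + ε) ^ (m₀ + (i + 1 : ℕ)))) C}

/-- `g` maps each pixel to a pixel at the next scale that contains it. (For pixels of positive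
side length there is exactly one; only for a point of `P` that lies on the common boundary
of several new pixels there is a choice.) -/
def IsPixelMap (m₀ : ℤ) (g : ℕ → Set (Pt d) → Set (Pt d)) : Prop :=
  ∀ i, ∀ C ∈ lazyPixels ε rep m₀ i, C ⊆ g i C ∧ g i C ∈ lazyPixels ε rep m₀ (i + 1)

variable {ε rep}

/-- The tower `LX`: the nerves of the collections `LS_α`, connected by the maps `g`. -/
def lazyTower {m₀ : ℤ} {g : ℕ → Set (Pt d) → Set (Pt d)} (hg : IsPixelMap ε rep m₀ g) :
    SimplicialTower (Set (Pt d)) where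
  cpx i := nerveCpx (lazyPixels ε rep m₀ i)
  vmap := g
  simplicial := by
    rintro i σ ⟨τ, ⟨hne, hS, x, hx⟩, rfl⟩
    refine ⟨Finset.image_nonempty.mpr hne, ?_, x, ?_⟩
    · intro C hC
      obtain ⟨D, hD, rfl⟩ := Finset.mem_image.mp hC
      exact (hg i D (hS D hD)).2
    · simp only [Set.mem_iInter] at hx ⊢
      intro C hC
      obtain ⟨D, hD, rfl⟩ := Finset.mem_image.mp hC
      exact (hg i D (hS D hD)).1 (hx D hD)

theorem gridSide_pos [NeZero d] (hε : 0 < ε) (α : ℝ) : 0 < gridSide d ε α := by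
  have : (0 : ℝ) < d := by exact_mod_cast Nat.pos_of_ne_zero (NeZero.ne d)
  unfold gridSide
  positivity

theorem newPixels_finite (hε : 0 < ε) (α : ℝ) : (newPixels ε rep α).Finite := by
  set s := gridSide d ε α with hs
  set ρ := (1 + ε / 2) * α with hρ
  have key : ∀ p : Pt d, {z : Fin d → ℤ | dist (pixelCenter s z) p ≤ ρ}.Finite := by
    intro p
    rcases Nat.eq_zero_or_pos d with h0 | h0
    · subst h0
      exact Set.toFinite _
    · have : NeZero d := ⟨h0.ne'⟩
      have hsp : 0 < s := gridSide_pos hε α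
      refine (Set.finite_Icc (fun i => ⌊(p i - ρ) / s - 1⌋)
        (fun i => ⌈(p i + ρ) / s⌉)).subset ?_
      intro z hz
      have hc : ∀ i, |s * (z i + 1 / 2) - p i| ≤ ρ := by
        intro i
        have h1 := PiLp.norm_apply_le (pixelCenter s z - p) i
        rw [← dist_eq_norm] at h1
        have h2 := h1.trans hz
        simpa [pixelCenter, Real.norm_eq_abs] using h2
      refine ⟨fun i => ?_, fun i => ?_⟩
      · have h1 := (abs_le.mp (hc i)).1
        have h2 : (p i - ρ) / s ≤ z i + 1 / 2 := by
          rw [div_le_iff₀ hsp]; linarith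
        have h3 : ((⌊(p i - ρ) / s - 1⌋ : ℤ) : ℝ) ≤ z i := by
          have := Int.floor_le ((p i - ρ) / s - 1)
          linarith
        exact_mod_cast h3
      · have h1 := (abs_le.mp (hc i)).2
        have h2 : (z i : ℝ) + 1 / 2 ≤ (p i + ρ) / s := by
          rw [le_div_iff₀ hsp]; linarith
        have h3 : (z i : ℝ) ≤ ((⌈(p i + ρ) / s⌉ : ℤ) : ℝ) := by
          have := Int.le_ceil ((p i + ρ) / s)
          linarith
        exact_mod_cast h3
  refine (P.finite_toSet.biUnion fun p _ => (key p).image (pixel s)).subset ?_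
  rintro C ⟨p, hp, hact, z, hz, rfl⟩
  rw [hact] at hz
  exact Set.mem_biUnion (by exact_mod_cast hp) ⟨z, hz, rfl⟩

theorem lazyPixels_finite (hε : 0 < ε) (m₀ : ℤ) (i : ℕ) : (lazyPixels ε rep m₀ i).Finite := by
  induction i with
  | zero =>
    refine (P.finite_toSet.image fun p => ({p} : Set (Pt d))).subset ?_
    rintro C ⟨p, hp, rfl⟩
    exact ⟨p, by exact_mod_cast hp, rfl⟩
  | succ i ih => exact (ih.union (newPixels_finite hε _)).subset fun C hC => hC.1

/-- The maps connecting the scales exist. -/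
theorem exists_isPixelMap (hε : 0 < ε) (m₀ : ℤ) : ∃ g, IsPixelMap ε rep m₀ g := by
  have h : ∀ i C, ∃ D, C ∈ lazyPixels ε rep m₀ i →
      C ⊆ D ∧ D ∈ lazyPixels ε rep m₀ (i + 1) := by
    intro i C
    by_cases hC : C ∈ lazyPixels ε rep m₀ i
    · obtain ⟨D, hCD, hD⟩ := ((lazyPixels_finite (rep := rep) hε m₀ i).union
        (newPixels_finite hε ((1 + ε) ^ (m₀ + (i + 1 : ℕ))))).exists_le_maximal (Or.inl hC)
      exact ⟨D, fun _ => ⟨hCD, hD⟩⟩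
    · exact ⟨C, fun h => absurd h hC⟩
  choose g hg using h
  exact ⟨g, fun i C hC => hg i C hC⟩

end construction

end LazyCech

/-!
*Existence of a WSPD.* Choose nested nets `N k` of `P` at the scales `r = R / 2 ^ k`
(`exists_nested_nets`) and take, for all `k` and all `x, y ∈ N k` whose distance is of the order of
`r / δ`, the pair of clusters of radius `r` around `x` and `y`. For every pair of points some scale
fits, so these pairs cover. The points `x` and `y` cannot both belong to a net whose scale exceeds
their distance, so one of them enters the nets fewer than `h` steps before `k`, if
`7 / δ ≤ 2 ^ h`. Charging the pair to that point, and bounding the choices of the other one by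
packing (`card_le_of_separated_of_dist_le`), bounds the number of pairs linearly in `n`
(`exists_wspd`).

*Size of the tower.* Connecting maps fix the pixels that survive, so a simplex included at scale `α`
has a vertex `C` that is a new pixel (`exists_notMem_lazyPixels_of_mem_included`), added around an
active point `p`. The key fact is that each other vertex `C'` then has been added at a scale above
`α / 2` (`exists_mem_newPixels_of_inter`). Otherwise `C'` is a point `p'`, or has been added around
a point `p'` at a scale of at most `α / 2`. Either the center of `C'` lies in the ball of `p`, or
`|pp'|` is comparable to `α`, and the WSPD pair that covers `p` and `p'` has a representative
`b` close to `p'` that is active at scale `α` (`exists_active_near`). In both cases the new pixels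
around an active point cover the center of `C'`, and one of them contains `C'` since the grids are
nested. By maximality this pixel is `C'`, which is absurd for a degenerate pixel, and otherwise
means that `C'` has been added at scale `α` itself.

Now charge a simplex included at scale `α` to its vertex `C` that was added earliest, at a scale
`α'`. As `α < 2 α'`, there are `O(1 / ε)` possible scales `α` for each `(C, α')`. The other vertices
have at least the side length of `C`, touch `C` and have disjoint interiors, so there are at most
`3 ^ d` candidates for them (`exists_injOn_position`) and at most `3 ^ (d k)` simplices. Finally,
each pair of the WSPD keeps two points active during `O(1 / ε)` scales, and an active point adds at
most `(18 √d / ε) ^ d` pixels at a scale (`exists_finset_newPixels`).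
-/

namespace LazyCech

/-! ### Packing and nets -/

open Module MeasureTheory Metric ENNReal in
/-- Packing bound, by comparing the volume of disjoint balls of radius `r / 2` around the points
with that of a ball of radius `L r + r / 2`. -/
theorem card_le_of_separated_of_dist_le {E : Type*} [NormedAddCommGroup E] [NormedSpace ℝ E]
    [FiniteDimensional ℝ E] {s : Finset E} {x : E} {r L : ℝ} (hr : 0 < r) (hL : 0 ≤ L)
    (hs : ∀ c ∈ s, dist c x ≤ L * r)
    (hsep : ∀ c ∈ s, ∀ c' ∈ s, c ≠ c' → r ≤ dist c c') :
    (s.card : ℝ) ≤ (2 * L + 1) ^ finrank ℝ E := by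
  borelize E
  let μ : Measure E := Measure.addHaar
  have hδ : 0 < r / 2 := by positivity
  have hρ : 0 < (2 * L + 1) * (r / 2) := by positivity
  have hdisj : Set.Pairwise (s : Set E) (Function.onFun Disjoint fun c => ball (c : E) (r / 2)) := by
    rintro c hc c' hc' hne
    apply ball_disjoint_ball
    have := hsep c hc c' hc' hne
    linarith
  have hsub : (⋃ c ∈ s, ball (c : E) (r / 2)) ⊆ ball x ((2 * L + 1) * (r / 2)) := by
    refine Set.iUnion₂_subset fun c hc => ?_
    apply ball_subset_ball'
    have := hs c hc
    linarith
  have hvol : (s.card : ℝ≥0∞) * ENNReal.ofReal ((r / 2) ^ finrank ℝ E) * μ (ball 0 1) ≤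
      ENNReal.ofReal (((2 * L + 1) * (r / 2)) ^ finrank ℝ E) * μ (ball 0 1) := by
    have h := measure_mono (μ := μ) hsub
    rw [measure_biUnion_finset hdisj fun c _ => measurableSet_ball] at h
    simpa only [μ.addHaar_ball_of_pos _ hδ, μ.addHaar_ball_of_pos _ hρ, Finset.sum_const,
      nsmul_eq_mul, mul_assoc] using h
  have hcard : (s.card : ℝ≥0∞) * ENNReal.ofReal ((r / 2) ^ finrank ℝ E) ≤
      ENNReal.ofReal (((2 * L + 1) * (r / 2)) ^ finrank ℝ E) :=
    (ENNReal.mul_le_mul_iff_left (measure_ball_pos _ _ zero_lt_one).ne'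
      measure_ball_lt_top.ne).1 hvol
  have h := ENNReal.toReal_le_of_le_ofReal (by positivity) hcard
  rw [ENNReal.toReal_mul, ENNReal.toReal_ofReal (by positivity), mul_pow,
    ENNReal.toReal_natCast] at h
  exact le_of_mul_le_mul_right h (by positivity)

section Nets

variable {X : Type*} [MetricSpace X]

/-- A separated subset of a finite set extends to a maximal one, which is a net. -/
theorem exists_net_extension (P : Finset X) {r : ℝ} (hr : 0 ≤ r) (S : Finset X) (hS : S ⊆ P)
    (hsep : ∀ x ∈ S, ∀ y ∈ S, x ≠ y → r < dist x y) :
    ∃ N : Finset X, S ⊆ N ∧ N ⊆ P ∧ (∀ x ∈ N, ∀ y ∈ N, x ≠ y → r < dist x y) ∧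
      ∀ p ∈ P, ∃ x ∈ N, dist p x ≤ r := by
  classical
  have hfin : {N : Finset X | N ⊆ P ∧ ∀ x ∈ N, ∀ y ∈ N, x ≠ y → r < dist x y}.Finite :=
    (P.powerset.finite_toSet).subset fun N hN => by simpa using hN.1
  obtain ⟨N, hSN, hN⟩ := hfin.exists_le_maximal (a := S) ⟨hS, hsep⟩
  refine ⟨N, hSN, hN.prop.1, hN.prop.2, fun p hp => ?_⟩
  by_contra! hfar
  have hpN : p ∉ N := fun h => by
    have := hfar p h
    rw [dist_self] at this
    linarith
  refine hpN (hN.le_of_ge (y := insert p N) ⟨Finset.insert_subset hp hN.prop.1, ?_⟩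
    (Finset.subset_insert p N) (Finset.mem_insert_self p N))
  intro x hx y hy hne
  rcases Finset.mem_insert.mp hx with rfl | hxN <;>
    rcases Finset.mem_insert.mp hy with rfl | hyN
  · exact absurd rfl hne
  · exact hfar y hyN
  · rw [dist_comm]
    exact hfar x hxN
  · exact hN.prop.2 x hxN y hyN hne

/-- Nested nets of a finite set at the scales `R / 2 ^ k`. -/
theorem exists_nested_nets (P : Finset X) {R : ℝ} (hR : 0 < R) :
    ∃ N : ℕ → Finset X, Monotone N ∧ (∀ k, N k ⊆ P) ∧
      (∀ k, ∀ x ∈ N k, ∀ y ∈ N k, x ≠ y → R / 2 ^ k < dist x y) ∧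
      ∀ k, ∀ p ∈ P, ∃ x ∈ N k, dist p x ≤ R / 2 ^ k := by
  classical
  have hext : ∀ (k : ℕ) (S : Finset X), ∃ N : Finset X,
      S ⊆ P ∧ (∀ x ∈ S, ∀ y ∈ S, x ≠ y → R / 2 ^ k < dist x y) →
      S ⊆ N ∧ N ⊆ P ∧ (∀ x ∈ N, ∀ y ∈ N, x ≠ y → R / 2 ^ k < dist x y) ∧
      ∀ p ∈ P, ∃ x ∈ N, dist p x ≤ R / 2 ^ k := by
    intro k S
    by_cases h : S ⊆ P ∧ ∀ x ∈ S, ∀ y ∈ S, x ≠ y → R / 2 ^ k < dist x y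
    · obtain ⟨N, hN⟩ := exists_net_extension P (by positivity) S h.1 h.2
      exact ⟨N, fun _ => hN⟩
    · exact ⟨∅, fun h' => absurd h' h⟩
  choose f hf using hext
  let N : ℕ → Finset X := fun k => Nat.rec (f 0 ∅) (fun k S => f (k + 1) S) k
  have hnext : ∀ k, N k ⊆ P → (∀ x ∈ N k, ∀ y ∈ N k, x ≠ y → R / 2 ^ k < dist x y) →
      N k ⊆ N (k + 1) ∧ N (k + 1) ⊆ P ∧
      (∀ x ∈ N (k + 1), ∀ y ∈ N (k + 1), x ≠ y → R / 2 ^ (k + 1) < dist x y) ∧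
      ∀ p ∈ P, ∃ x ∈ N (k + 1), dist p x ≤ R / 2 ^ (k + 1) := by
    intro k h1 h2
    refine hf (k + 1) (N k) ⟨h1, fun x hx y hy hne => lt_of_le_of_lt ?_ (h2 x hx y hy hne)⟩
    gcongr
    · norm_num
    · omega
  have hN : ∀ k, N k ⊆ P ∧ (∀ x ∈ N k, ∀ y ∈ N k, x ≠ y → R / 2 ^ k < dist x y) ∧
      ∀ p ∈ P, ∃ x ∈ N k, dist p x ≤ R / 2 ^ k := by
    intro k
    induction k with
    | zero => exact (hf 0 ∅ ⟨by simp, by simp⟩).2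
    | succ k ih => exact (hnext k ih.1 ih.2.1).2
  exact ⟨N, monotone_nat_of_le_succ fun k => (hnext k (hN k).1 (hN k).2.1).1,
    fun k => (hN k).1, fun k => (hN k).2.1, fun k => (hN k).2.2⟩

end Nets

/-! ### Well-separated pairs from nets -/

section Existence

variable {d : ℕ}

/-- The part of `P` in the closed ball of radius `r` around `x`. -/
noncomputable def cluster (P : Finset (Pt d)) (r : ℝ) (x : Pt d) : Finset (Pt d) :=
  P.filter fun p => dist p x ≤ r

theorem mem_cluster {P : Finset (Pt d)} {r : ℝ} {x p : Pt d} :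
    p ∈ cluster P r x ↔ p ∈ P ∧ dist p x ≤ r := by
  simp [cluster]

theorem diam_cluster_le {P : Finset (Pt d)} {r : ℝ} (hr : 0 ≤ r) (x : Pt d) :
    Metric.diam (cluster P r x : Set (Pt d)) ≤ 2 * r := by
  refine Metric.diam_le_of_forall_dist_le (by positivity) fun p hp q hq => ?_
  have h1 := (mem_cluster.mp (Finset.mem_coe.mp hp)).2
  have h2 := (mem_cluster.mp (Finset.mem_coe.mp hq)).2
  have := dist_triangle_right p q x
  linarith

open scoped Classical in
/-- Existence of a linear size WSPD. The pairs are the clusters of radius `r = R / 2 ^ k` around two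
points of the net at scale `r` whose distance is of the order of `r / δ`. These two points cannot
both belong to the net at a scale larger than their distance, so that one of them appears for the
first time fewer than `h` steps before `k`, where `7 / δ ≤ 2 ^ h`; the pair is charged to that
point. -/
theorem exists_wspd (P : Finset (Pt d)) {δ : ℝ} (hδ : 0 < δ) (hδ' : δ ≤ 1 / 4) :
    ∃ W : WSPD P δ, (W.pairs.card : ℝ) ≤ P.card * ((7 / δ + 1) * (15 / δ) ^ d) := by
  obtain ⟨R₀, hR₀⟩ := (Metric.isBounded_iff (s := (P : Set (Pt d)))).mp P.finite_toSet.isBounded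
  obtain ⟨R, hR, hPR⟩ : ∃ R : ℝ, 0 < R ∧ ∀ p ∈ P, ∀ q ∈ P, dist p q ≤ R :=
    ⟨max R₀ 1, by positivity, fun p hp q hq => (hR₀ hp hq).trans (le_max_left _ _)⟩
  obtain ⟨N, hmono, hNP, hsep, hcov⟩ := exists_nested_nets P hR
  set r : ℕ → ℝ := fun k => R / 2 ^ k with hrdef
  have hr : ∀ k, 0 < r k := fun k => by simp only [hrdef]; positivity
  have hδ4 : 4 ≤ 1 / δ := by rw [le_div_iff₀ hδ]; linarith
  -- the first scale at which a point belongs to the net (`0` if there is none)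
  let β : Pt d → ℕ := fun z => sInf {k | z ∈ N k}
  have hβ : ∀ {z k}, z ∈ N k → z ∈ N (β z) ∧ β z ≤ k := fun {z k} hz =>
    ⟨Nat.sInf_mem (s := {k | z ∈ N k}) ⟨k, hz⟩, Nat.sInf_le (s := {k | z ∈ N k}) hz⟩
  -- `h = O(log (1 / δ))` would do, but the bound leaves room for a factor `1 / δ`
  let h : ℕ := ⌈7 / δ⌉₊
  have h2 : 7 / δ ≤ 2 ^ h := (Nat.le_ceil _).trans (by exact_mod_cast Nat.lt_two_pow_self.le)
  let near : Pt d → ℕ → Finset (Pt d) := fun z k => (N k).filter fun y =>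
    z ∈ N k ∧ (2 / δ + 2) * r k ≤ dist z y ∧ dist z y ≤ 7 / δ * r k
  let pairs : Finset (Finset (Pt d) × Finset (Pt d)) := P.biUnion fun z =>
    (Finset.range h).biUnion fun j => (near z (β z + j)).image fun y =>
      (cluster P (r (β z + j)) z, cluster P (r (β z + j)) y)
  have hpairs : ∀ w ∈ pairs, ∃ k, ∃ z ∈ N k, ∃ y ∈ N k, (2 / δ + 2) * r k ≤ dist z y ∧
      w = (cluster P (r k) z, cluster P (r k) y) := by
    intro w hw
    simp only [pairs, near, Finset.mem_biUnion, Finset.mem_image, Finset.mem_filter] at hw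
    obtain ⟨z, -, j, -, y, ⟨hy, hz, hlo, -⟩, rfl⟩ := hw
    exact ⟨_, z, hz, y, hy, hlo, rfl⟩
  -- the pair of clusters is recorded if the first point is the more recent one
  have hmem : ∀ k z y, z ∈ N k → y ∈ N k → (2 / δ + 2) * r k ≤ dist z y →
      dist z y ≤ 7 / δ * r k → β y ≤ β z →
      (cluster P (r k) z, cluster P (r k) y) ∈ pairs := by
    intro k z y hz hy hlo hhi hβzy
    obtain ⟨hzβ, hβk⟩ := hβ hz
    have hne : z ≠ y := by
      rintro rfl
      rw [dist_self] at hlo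
      have : 0 < (2 / δ + 2) * r k := mul_pos (by positivity) (hr k)
      linarith
    have hlt : k < β z + h := by
      by_contra! hle
      obtain ⟨m, rfl⟩ := Nat.exists_eq_add_of_le' hle
      have hyβ : y ∈ N (β z) := hmono hβzy (hβ hy).1
      have h3 := hsep (β z) z hzβ y hyβ hne
      have h4 : 7 / δ * r (m + (β z + h)) ≤ R / 2 ^ β z := by
        simp only [hrdef]
        rw [pow_add, pow_add, mul_div_assoc', div_le_div_iff₀ (by positivity) (by positivity)]
        have h5 : (1 : ℝ) ≤ 2 ^ m := one_le_pow₀ (by norm_num)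
        have h6 : 7 / δ ≤ 2 ^ m * 2 ^ h := h2.trans (le_mul_of_one_le_left (by positivity) h5)
        calc 7 / δ * R * 2 ^ β z ≤ (2 ^ m * 2 ^ h) * R * 2 ^ β z := by gcongr
          _ = R * (2 ^ m * (2 ^ β z * 2 ^ h)) := by ring
      linarith
    simp only [pairs, near, Finset.mem_biUnion, Finset.mem_image, Finset.mem_filter]
    refine ⟨z, hNP k hz, k - β z, Finset.mem_range.mpr (by omega), y, ?_⟩
    rw [Nat.add_sub_cancel' hβk]
    exact ⟨⟨hy, hz, hlo, hhi⟩, rfl⟩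
  have hsepw : ∀ w ∈ pairs, ∀ p ∈ w.1, ∀ q ∈ w.2,
      Metric.diam (w.1 : Set (Pt d)) ≤ δ * dist p q ∧
        Metric.diam (w.2 : Set (Pt d)) ≤ δ * dist p q := by
    intro w hw p hp q hq
    obtain ⟨k, z, hz, y, hy, hlo, rfl⟩ := hpairs w hw
    have h1 := (mem_cluster.mp hp).2
    have h2 := (mem_cluster.mp hq).2
    have h3 : dist z y ≤ dist p z + dist p q + dist q y := by
      have := dist_triangle4 z p q y
      rwa [dist_comm z p] at this
    have h4 : 2 * r k ≤ δ * dist p q := by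
      have h5 : 2 / δ * r k ≤ dist p q := by linarith
      calc 2 * r k = δ * (2 / δ * r k) := by field_simp
        _ ≤ δ * dist p q := by gcongr
    exact ⟨(diam_cluster_le (hr k).le z).trans h4, (diam_cluster_le (hr k).le y).trans h4⟩
  have hcovw : ∀ p ∈ P, ∀ q ∈ P, p ≠ q →
      ∃ w ∈ pairs, (p ∈ w.1 ∧ q ∈ w.2) ∨ (p ∈ w.2 ∧ q ∈ w.1) := by
    intro p hp q hq hpq
    have hD : 0 < dist p q := dist_pos.mpr hpq
    -- the largest scale that is at most `δ |pq| / 3`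
    have hex : ∃ k, r k ≤ δ / 3 * dist p q := by
      obtain ⟨k, hk⟩ := pow_unbounded_of_one_lt (R / (δ / 3 * dist p q)) (one_lt_two (α := ℝ))
      refine ⟨k, ?_⟩
      rw [div_lt_iff₀ (by positivity)] at hk
      simp only [hrdef]
      rw [div_le_iff₀ (by positivity)]
      linarith
    have hk := Nat.find_spec hex
    have hmin : ∀ m < Nat.find hex, ¬ r m ≤ δ / 3 * dist p q := fun m hm => Nat.find_min hex hm
    generalize Nat.find hex = k at hk hmin
    obtain ⟨m, rfl⟩ : ∃ m, k = m + 1 := by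
      refine Nat.exists_eq_succ_of_ne_zero ?_
      rintro rfl
      have h1 := hPR p hp q hq
      simp only [hrdef, pow_zero, div_one] at hk
      nlinarith
    have hm := not_le.mp (hmin m (Nat.lt_succ_self m))
    have hrm : r m = 2 * r (m + 1) := by
      simp only [hrdef, pow_succ]
      field_simp
    obtain ⟨x, hx, hpx⟩ := hcov (m + 1) p hp
    obtain ⟨y, hy, hqy⟩ := hcov (m + 1) q hq
    change dist p x ≤ r (m + 1) at hpx
    change dist q y ≤ r (m + 1) at hqy
    have h1 : dist p q ≤ dist p x + dist x y + dist q y := by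
      have := dist_triangle4 p x y q
      rwa [dist_comm y q] at this
    have h3 : dist x y ≤ dist p x + dist p q + dist q y := by
      have := dist_triangle4 x p q y
      rwa [dist_comm x p] at this
    have h4 : 3 / δ * r (m + 1) ≤ dist p q := by
      calc 3 / δ * r (m + 1) ≤ 3 / δ * (δ / 3 * dist p q) := by gcongr
        _ = dist p q := by field_simp
    have h5 : dist p q ≤ 6 / δ * r (m + 1) := by
      calc dist p q = 3 / δ * (δ / 3 * dist p q) := by field_simp
        _ ≤ 3 / δ * r m := by gcongr
        _ = 6 / δ * r (m + 1) := by rw [hrm]; ring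
    have h6 : 4 * r (m + 1) ≤ 1 / δ * r (m + 1) := by gcongr
    have e2 : 2 / δ = 2 * (1 / δ) := by ring
    have e3 : 3 / δ = 3 * (1 / δ) := by ring
    have e6 : 6 / δ = 6 * (1 / δ) := by ring
    have e7 : 7 / δ = 7 * (1 / δ) := by ring
    rw [e3] at h4
    rw [e6] at h5
    have hlo : (2 / δ + 2) * r (m + 1) ≤ dist x y := by
      rw [e2]; linarith
    have hhi : dist x y ≤ 7 / δ * r (m + 1) := by
      rw [e7]; linarith
    have hpc : p ∈ cluster P (r (m + 1)) x := mem_cluster.mpr ⟨hp, hpx⟩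
    have hqc : q ∈ cluster P (r (m + 1)) y := mem_cluster.mpr ⟨hq, hqy⟩
    rcases le_total (β y) (β x) with hβ' | hβ'
    · exact ⟨_, hmem _ x y hx hy hlo hhi hβ', Or.inl ⟨hpc, hqc⟩⟩
    · rw [dist_comm] at hlo hhi
      exact ⟨_, hmem _ y x hy hx hlo hhi hβ', Or.inr ⟨hpc, hqc⟩⟩
  refine ⟨⟨pairs, fun w hw => ?_, fun w hw => ?_, hsepw, hcovw⟩, ?_⟩
  · obtain ⟨k, z, hz, y, hy, hlo, rfl⟩ := hpairs w hw
    exact ⟨Finset.filter_subset _ _, Finset.filter_subset _ _⟩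
  · obtain ⟨k, z, hz, y, hy, hlo, rfl⟩ := hpairs w hw
    exact ⟨⟨z, mem_cluster.mpr ⟨hNP k hz, by rw [dist_self]; exact (hr k).le⟩⟩,
      ⟨y, mem_cluster.mpr ⟨hNP k hy, by rw [dist_self]; exact (hr k).le⟩⟩⟩
  · have hnear : ∀ z k, ((near z k).card : ℝ) ≤ (15 / δ) ^ d := by
      intro z k
      have h1 : ((near z k).card : ℝ) ≤ (2 * (7 / δ) + 1) ^ Module.finrank ℝ (Pt d) := by
        refine card_le_of_separated_of_dist_le (x := z) (hr k) (by positivity) ?_ ?_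
        · intro y hy
          rw [dist_comm]
          exact (Finset.mem_filter.mp hy).2.2.2
        · intro y hy y' hy' hne
          exact (hsep k y (Finset.mem_filter.mp hy).1 y' (Finset.mem_filter.mp hy').1 hne).le
      rw [finrank_euclideanSpace_fin] at h1
      refine h1.trans (pow_le_pow_left₀ (by positivity) ?_ d)
      have e7 : 7 / δ = 7 * (1 / δ) := by ring
      have e15 : 15 / δ = 15 * (1 / δ) := by ring
      rw [e7, e15]
      linarith
    have hcard : (pairs.card : ℝ) ≤ ∑ z ∈ P, ∑ j ∈ Finset.range h, (15 / δ) ^ d := by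
      have h1 : pairs.card ≤ ∑ z ∈ P, ∑ j ∈ Finset.range h, (near z (β z + j)).card :=
        Finset.card_biUnion_le.trans <| Finset.sum_le_sum fun z _ =>
          Finset.card_biUnion_le.trans <| Finset.sum_le_sum fun j _ => Finset.card_image_le
      refine (Nat.cast_le.mpr h1).trans ?_
      push_cast
      exact Finset.sum_le_sum fun z _ => Finset.sum_le_sum fun j _ => hnear _ _
    refine hcard.trans ?_
    simp only [Finset.sum_const, nsmul_eq_mul, Finset.card_range]
    gcongr
    exact (Nat.ceil_lt_add_one (by positivity)).le

end Existence

/-! ### Grid pixels -/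

section Grid

variable {d : ℕ}

theorem pixelCenter_mem_pixel {s : ℝ} (hs : 0 ≤ s) (z : Fin d → ℤ) :
    pixelCenter s z ∈ pixel s z := by
  intro i
  simp only [pixelCenter]
  constructor <;> nlinarith

theorem mem_pixel_floor {s : ℝ} (hs : 0 < s) (y : Pt d) : y ∈ pixel s fun i => ⌊y i / s⌋ := by
  intro i
  constructor
  · rw [mul_comm, ← le_div_iff₀ hs]
    exact Int.floor_le _
  · rw [mul_comm, ← div_le_iff₀ hs]
    exact (Int.lt_floor_add_one _).le

theorem dist_pixelCenter_le {s : ℝ} (hs : 0 ≤ s) {z : Fin d → ℤ} {y : Pt d} (hy : y ∈ pixel s z) :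
    dist y (pixelCenter s z) ≤ √(d : ℝ) * (s / 2) := by
  rw [EuclideanSpace.dist_eq, Real.sqrt_le_left (by positivity), mul_pow,
    Real.sq_sqrt (Nat.cast_nonneg d)]
  have h : ∀ i ∈ Finset.univ, dist (y i) (pixelCenter s z i) ^ 2 ≤ (s / 2) ^ 2 := by
    intro i _
    obtain ⟨h1, h2⟩ := hy i
    rw [Real.dist_eq, sq_abs]
    apply sq_le_sq' <;> simp only [pixelCenter] <;> linarith
  simpa using Finset.sum_le_sum h

/-- Two pixels whose open coordinate intervals overlap in each coordinate are nested if the side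
of the larger one is a multiple of that of the smaller one. -/
theorem pixel_subset_of_overlap {s : ℝ} (hs : 0 < s) {M : ℕ} {a b : Fin d → ℤ}
    (h : ∀ i, s * M * b i < s * (a i + 1) ∧ s * a i < s * M * (b i + 1)) :
    pixel s a ⊆ pixel (s * M) b := by
  have h' : ∀ i, s * M * b i ≤ s * a i ∧ s * (a i + 1) ≤ s * M * (b i + 1) := by
    intro i
    obtain ⟨h1, h2⟩ := h i
    rw [mul_assoc] at h1 h2 ⊢
    rw [mul_lt_mul_iff_right₀ hs] at h1 h2
    rw [mul_assoc, mul_le_mul_iff_right₀ hs, mul_le_mul_iff_right₀ hs]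
    norm_cast at h1 h2 ⊢
    exact ⟨by linarith, by linarith⟩
  intro x hx i
  exact ⟨(h' i).1.trans (hx i).1, (hx i).2.trans (h' i).2⟩

/-- A pixel lies below or above each pixel of a grid that it refines, in each coordinate, unless
it lies inside. -/
theorem interval_trichotomy {s : ℝ} (hs : 0 < s) (M : ℕ) (a b : ℤ) :
    s * M * (b + 1) ≤ s * a ∨ s * (a + 1) ≤ s * M * b ∨
      (s * M * b ≤ s * a ∧ s * (a + 1) ≤ s * M * (b + 1)) := by
  simp only [mul_assoc, mul_le_mul_iff_right₀ hs]
  norm_cast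
  omega

theorem not_subsingleton_pixel [NeZero d] {s : ℝ} (hs : 0 < s) (z : Fin d → ℤ) (p : Pt d) :
    ¬ pixel s z ⊆ {p} := by
  intro h
  have h1 : (WithLp.toLp 2 fun i => s * z i : Pt d) ∈ pixel s z := fun i => by
    constructor <;> simp only <;> nlinarith
  have h2 : (WithLp.toLp 2 fun i => s * (z i + 1) : Pt d) ∈ pixel s z := fun i => by
    constructor <;> simp only <;> nlinarith
  have h3 := (h h1 : _ = p).trans (h h2 : _ = p).symm
  have h4 := congrArg (fun x : Pt d => x 0) h3
  simp only at h4
  nlinarith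

theorem gridSide_le [NeZero d] {ε α : ℝ} (hε : 0 ≤ ε) (hα : 0 < α) :
    √(d : ℝ) * (gridSide d ε α / 2) ≤ ε / 8 * α := by
  have hd : (0 : ℝ) < d := by exact_mod_cast Nat.pos_of_ne_zero (NeZero.ne d)
  have h1 : (2 : ℝ) ^ Int.log 2 α ≤ α := by exact_mod_cast Int.zpow_log_le_self (by norm_num) hα
  have h2 : √(d : ℝ) * (gridSide d ε α / 2) = ε / 8 * 2 ^ Int.log 2 α := by
    have : 0 < √(d : ℝ) := Real.sqrt_pos.mpr hd
    unfold gridSide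
    field_simp
    ring
  rw [h2]
  gcongr

theorem lt_gridSide [NeZero d] {ε : ℝ} (hε : 0 < ε) (α : ℝ) :
    ε * α < 8 * √(d : ℝ) * gridSide d ε α := by
  have hd : (0 : ℝ) < d := by exact_mod_cast Nat.pos_of_ne_zero (NeZero.ne d)
  have h1 : α < 2 ^ (Int.log 2 α + 1) := by
    exact_mod_cast Int.lt_zpow_succ_log_self (b := 2) (by norm_num) α
  have h2 : 8 * √(d : ℝ) * gridSide d ε α = ε * 2 ^ (Int.log 2 α + 1) := by
    have : 0 < √(d : ℝ) := Real.sqrt_pos.mpr hd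
    rw [zpow_add_one₀ (by norm_num)]
    unfold gridSide
    field_simp
    norm_num
  rw [h2]
  gcongr

/-- The grid at a scale refines the grids at the larger scales. -/
theorem exists_gridSide_eq_mul (d : ℕ) (ε : ℝ) {α α' : ℝ} (hα : 0 < α) (h : α ≤ α') :
    ∃ M : ℕ, gridSide d ε α' = gridSide d ε α * M := by
  obtain ⟨n, hn⟩ := Int.eq_ofNat_of_zero_le (sub_nonneg.mpr (Int.log_mono_right (b := 2) hα h))
  refine ⟨2 ^ n, ?_⟩
  have : Int.log 2 α' = Int.log 2 α + n := by omega
  unfold gridSide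
  rw [this, zpow_add₀ (by norm_num)]
  push_cast
  rw [zpow_natCast]
  ring

end Grid

/-! ### Active points -/

section Active

variable {d : ℕ} {P : Finset (Pt d)} {δ ε : ℝ} {W : WSPD P δ} {rep : Reps W}

theorem left_mem_points (rep : Reps W) {w : Finset (Pt d) × Finset (Pt d)} (hw : w ∈ W.pairs) :
    rep.left w ∈ P :=
  (W.subset w hw).1 (rep.left_mem w hw)

theorem right_mem_points (rep : Reps W) {w : Finset (Pt d) × Finset (Pt d)} (hw : w ∈ W.pairs) :
    rep.right w ∈ P :=
  (W.subset w hw).2 (rep.right_mem w hw)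

theorem lazyRadius_eq_of_mem {p : Pt d} {α : ℝ} (h : α ∈ activeScales ε rep p) :
    lazyRadius ε rep p α = α :=
  IsGreatest.csSup_eq ⟨⟨h, le_rfl⟩, fun _ hr => hr.2⟩

theorem isClosed_activeScales (p : Pt d) : IsClosed (activeScales ε rep p) := by
  have h : activeScales ε rep p =
      ⋃ w ∈ {w | w ∈ W.pairs ∧ (p = rep.left w ∨ p = rep.right w)}, pairInterval ε rep w := by
    ext α
    simp only [activeScales, Set.mem_ofPred_eq, Set.mem_iUnion, exists_prop, and_assoc]
  rw [h]
  refine Set.Finite.isClosed_biUnion (W.pairs.finite_toSet.subset fun w hw => hw.1) fun w _ => ?_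
  exact isClosed_Icc

/-- The maximum in the definition of the lazy radius is attained. -/
theorem mem_activeScales_of_lazyRadius_eq {p : Pt d} {α : ℝ} (hα : 0 < α)
    (h : lazyRadius ε rep p α = α) : α ∈ activeScales ε rep p := by
  have hne : {r | r ∈ activeScales ε rep p ∧ r ≤ α}.Nonempty := by
    by_contra hne
    rw [Set.not_nonempty_iff_eq_empty] at hne
    rw [lazyRadius, hne, Real.sSup_empty] at h
    exact hα.ne h
  have hcl : IsClosed {r | r ∈ activeScales ε rep p ∧ r ≤ α} :=
    (isClosed_activeScales p).inter isClosed_Iic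
  have hmem := hcl.csSup_mem hne ⟨α, fun _ hr => hr.2⟩
  have h' : sSup {r | r ∈ activeScales ε rep p ∧ r ≤ α} = α := h
  rw [h'] at hmem
  exact hmem.1

theorem exists_scale_ge (hε : 0 < ε) (b : ℝ) : ∃ x ∈ scales ε, b ≤ x := by
  obtain ⟨n, hn⟩ := pow_unbounded_of_one_lt b (show 1 < 1 + ε by linarith)
  exact ⟨(1 + ε) ^ n, ⟨n, (zpow_natCast _ n).symm⟩, hn.le⟩

theorem Icc_subset_enlarged (hε : 0 < ε) {a b : ℝ} (ha : 0 ≤ a) :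
    Set.Icc a b ⊆ enlarged ε a b := by
  refine Set.Icc_subset_Icc ?_ ?_
  · exact csSup_le ⟨0, Set.mem_insert _ _, ha⟩ fun x hx => hx.2
  · obtain ⟨x, hx, hbx⟩ := exists_scale_ge hε b
    exact le_csInf ⟨x, Set.mem_insert_of_mem _ hx, hbx⟩ fun y hy => hy.2

theorem enlarged_zero (hε : 0 < ε) : enlarged ε 0 0 = {0} := by
  have hpos : ∀ x ∈ insert 0 (scales ε), 0 ≤ x := by
    rintro x (rfl | ⟨m, rfl⟩)
    · exact le_rfl
    · positivity
  have h1 : IsGreatest {x | x ∈ insert 0 (scales ε) ∧ x ≤ 0} 0 :=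
    ⟨⟨Set.mem_insert _ _, le_rfl⟩, fun x hx => hx.2⟩
  have h2 : IsLeast {x | x ∈ insert 0 (scales ε) ∧ 0 ≤ x} 0 :=
    ⟨⟨Set.mem_insert _ _, le_rfl⟩, fun x hx => hx.2⟩
  rw [enlarged, h1.csSup_eq, h2.csInf_eq, Set.Icc_self]

/-- The enlargement moves each endpoint by a factor of at most `1 + ε`. -/
theorem enlarged_subset (hε : 0 < ε) {a b : ℝ} (ha : 0 < a) (hb : 0 < b) :
    enlarged ε a b ⊆ Set.Icc (a / (1 + ε)) ((1 + ε) * b) := by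
  have h1ε : 1 < 1 + ε := by linarith
  refine Set.Icc_subset_Icc ?_ ?_
  · obtain ⟨m, hm⟩ := exists_mem_Ico_zpow ha h1ε
    have hmem : (1 + ε) ^ m ∈ {x | x ∈ insert 0 (scales ε) ∧ x ≤ a} :=
      ⟨Set.mem_insert_of_mem _ ⟨m, rfl⟩, hm.1⟩
    refine le_trans ?_ (le_csSup ⟨a, fun x hx => hx.2⟩ hmem)
    rw [div_le_iff₀ (by positivity), ← zpow_add_one₀ (by positivity)]
    exact hm.2.le
  · obtain ⟨m, hm⟩ := exists_mem_Ioc_zpow hb h1ε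
    have hmem : (1 + ε) ^ (m + 1) ∈ {x | x ∈ insert 0 (scales ε) ∧ b ≤ x} :=
      ⟨Set.mem_insert_of_mem _ ⟨m + 1, rfl⟩, hm.2⟩
    refine (csInf_le ⟨b, fun x hx => hx.2⟩ hmem).trans ?_
    rw [zpow_add_one₀ (by positivity), mul_comm]
    gcongr
    exact hm.1.le

/-- If the point `p` is active at scale `α` and `p'` is a point of `P` within the order of `α` from
it (both are close to some `x`), then the points `y` near `p'` lie in the ball of radius `α` around an active point: either `p`
itself or the representative on the side of `p'` of a pair that covers `p` and `p'`. -/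
theorem exists_active_near (hε : 0 < ε) (hδ : δ ≤ 1 / 40) {p p' x y : Pt d}
    {α : ℝ} (hp : p ∈ P) (hp' : p' ∈ P) (hα : 0 < α) (hact : lazyRadius ε rep p α = α)
    (hx : dist x p ≤ 9 / 8 * α) (hxp' : dist x p' ≤ 9 / 16 * α) (hyp' : dist y p' ≤ 9 / 16 * α) :
    ∃ b ∈ P, lazyRadius ε rep b α = α ∧ dist y b ≤ α := by
  by_cases hy : dist y p ≤ α
  · exact ⟨p, hp, hact, hy⟩
  push Not at hy
  have hlo : 7 / 16 * α ≤ dist p p' := by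
    have := dist_triangle y p' p
    rw [dist_comm p' p] at this
    linarith
  have hhi : dist p p' ≤ 27 / 16 * α := by
    have := dist_triangle_left p p' x
    linarith
  have hD : 0 < dist p p' := by linarith
  -- a representative `a` of the side of `p` and a representative `b` of the side of `p'`
  have key : ∀ w ∈ W.pairs, ∀ a b : Pt d, ∀ A B : Finset (Pt d), p ∈ A → p' ∈ B → a ∈ A → b ∈ B →
      Metric.diam (A : Set (Pt d)) ≤ δ * dist p p' →
      Metric.diam (B : Set (Pt d)) ≤ δ * dist p p' →
      repDist rep w = dist a b → (b = rep.left w ∨ b = rep.right w) →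
      lazyRadius ε rep b α = α ∧ dist y b ≤ α := by
    intro w hw a b A B hpA hpB haA hbB hA hB hrep hb
    have h1 : dist p a ≤ 1 / 40 * dist p p' :=
      (Metric.dist_le_diam_of_mem A.finite_toSet.isBounded hpA haA).trans (hA.trans (by gcongr))
    have h2 : dist p' b ≤ 1 / 40 * dist p p' :=
      (Metric.dist_le_diam_of_mem B.finite_toSet.isBounded hpB hbB).trans (hB.trans (by gcongr))
    have h3 : dist a b ≤ dist p a + dist p p' + dist p' b := by
      have := dist_triangle4 a p p' b
      rwa [dist_comm a p] at this
    have h4 : dist p p' ≤ dist p a + dist a b + dist p' b := by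
      have := dist_triangle4 p a b p'
      rwa [dist_comm b p'] at this
    refine ⟨lazyRadius_eq_of_mem ⟨w, hw, hb, Icc_subset_enlarged hε ?_ ⟨?_, ?_⟩⟩, ?_⟩
    · rw [hrep]; positivity
    · rw [hrep]; linarith
    · rw [hrep]; linarith
    · have := dist_triangle y p' b
      linarith
  obtain ⟨w, hw, h | h⟩ := W.covers p hp p' hp' (dist_pos.mp hD)
  · have hs := W.separated w hw p h.1 p' h.2
    exact ⟨_, right_mem_points rep hw, key w hw (rep.left w) (rep.right w) w.1 w.2 h.1 h.2
      (rep.left_mem w hw) (rep.right_mem w hw) hs.1 hs.2 rfl (Or.inr rfl)⟩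
  · have hs := W.separated w hw p' h.2 p h.1
    rw [dist_comm p' p] at hs
    exact ⟨_, left_mem_points rep hw, key w hw (rep.right w) (rep.left w) w.2 w.1 h.1 h.2
      (rep.right_mem w hw) (rep.left_mem w hw) hs.2 hs.1 (dist_comm _ _) (Or.inl rfl)⟩

end Active

/-! ### The vertices of new simplices -/

/-- The scale of the tower at step `i`. -/
noncomputable def scaleAt (ε : ℝ) (m₀ : ℤ) (i : ℕ) : ℝ := (1 + ε) ^ (m₀ + i)

theorem scaleAt_pos {ε : ℝ} (hε : 0 < ε) (m₀ : ℤ) (i : ℕ) : 0 < scaleAt ε m₀ i := by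
  unfold scaleAt
  positivity

theorem scaleAt_mono {ε : ℝ} (hε : 0 < ε) (m₀ : ℤ) : Monotone (scaleAt ε m₀) := fun i j h =>
  zpow_le_zpow_right₀ (by linarith) (by omega)

theorem scaleAt_add {ε : ℝ} (hε : 0 < ε) (m₀ : ℤ) (i t : ℕ) :
    scaleAt ε m₀ (i + t) = scaleAt ε m₀ i * (1 + ε) ^ t := by
  unfold scaleAt
  rw [← zpow_natCast (1 + ε) t, ← zpow_add₀ (by positivity)]
  push_cast
  ring_nf

/-- A bound on the number of scales in an interval, by Bernoulli's inequality. -/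
theorem le_div_of_scaleAt_add_le {ε K : ℝ} (hε : 0 < ε) {m₀ : ℤ} {i t : ℕ}
    (h : scaleAt ε m₀ (i + t) ≤ K * scaleAt ε m₀ i) : (t : ℝ) ≤ (K - 1) / ε := by
  rw [scaleAt_add hε, mul_comm, mul_le_mul_iff_left₀ (scaleAt_pos hε m₀ i)] at h
  have := one_add_mul_le_pow (show (-2 : ℝ) ≤ ε by linarith) t
  rw [le_div_iff₀ hε]
  linarith

section Vertices

variable {d : ℕ} {P : Finset (Pt d)} {δ ε : ℝ} {W : WSPD P δ} {rep : Reps W} {m₀ : ℤ}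

theorem mem_lazyPixels_succ {i : ℕ} {C : Set (Pt d)} :
    C ∈ lazyPixels ε rep m₀ (i + 1) ↔ Maximal
      (fun D => D ∈ lazyPixels ε rep m₀ i ∪ newPixels ε rep (scaleAt ε m₀ (i + 1))) C :=
  Iff.rfl

theorem eq_of_subset_of_mem_lazyPixels_succ {i : ℕ} {C D : Set (Pt d)}
    (hC : C ∈ lazyPixels ε rep m₀ (i + 1))
    (hD : D ∈ lazyPixels ε rep m₀ i ∪ newPixels ε rep (scaleAt ε m₀ (i + 1))) (h : C ⊆ D) :
    C = D :=
  Maximal.eq_of_le (mem_lazyPixels_succ.mp hC) hD h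

/-- A pixel of the tower is a point of `P` or has been added at one of the previous steps. -/
theorem eq_singleton_or_mem_newPixels {i : ℕ} {C : Set (Pt d)} (hC : C ∈ lazyPixels ε rep m₀ i) :
    (∃ p ∈ P, C = {p}) ∨ ∃ j, 1 ≤ j ∧ j ≤ i ∧ C ∈ newPixels ε rep (scaleAt ε m₀ j) := by
  induction i with
  | zero => exact Or.inl hC
  | succ i ih =>
    rcases hC.1 with h | h
    · rcases ih h with h | ⟨j, h1, h2, h3⟩
      · exact Or.inl h
      · exact Or.inr ⟨j, h1, by omega, h3⟩
    · exact Or.inr ⟨i + 1, by omega, le_rfl, h⟩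

theorem exists_pixel_of_mem_newPixels {α : ℝ} {C : Set (Pt d)} (hC : C ∈ newPixels ε rep α) :
    ∃ z, C = pixel (gridSide d ε α) z := by
  obtain ⟨p, -, -, z, -, h⟩ := hC
  exact ⟨z, h⟩

open scoped Classical in
/-- At the minimal scale the complex consists of the points of `P`, as isolated vertices. -/
theorem mem_image_of_mem_included_zero {g : ℕ → Set (Pt d) → Set (Pt d)}
    (hg : IsPixelMap ε rep m₀ g) {k : ℕ} {σ : Finset (Set (Pt d))}
    (hσ : σ ∈ ((lazyTower hg).skeleton k).included 0) :
    σ ∈ P.image fun p => {{p}} := by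
  obtain ⟨⟨⟨C, hC⟩, hS, x, hx⟩, -⟩ := hσ
  obtain ⟨p, hp, rfl⟩ := hS C hC
  refine Finset.mem_image.mpr ⟨p, hp, Eq.symm ?_⟩
  refine Finset.eq_singleton_iff_unique_mem.mpr ⟨hC, fun D hD => ?_⟩
  obtain ⟨q, -, rfl⟩ := hS D hD
  simp only [Set.mem_iInter] at hx
  have h1 : x = p := hx _ hC
  have h2 : x = q := hx _ hD
  rw [← h1, ← h2]

open scoped Classical in
/-- A simplex all of whose vertices survive from the preceding step belongs to the image of the
preceding complex, since the connecting map fixes these vertices by their maximality. -/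
theorem exists_notMem_lazyPixels_of_mem_included {g : ℕ → Set (Pt d) → Set (Pt d)}
    (hg : IsPixelMap ε rep m₀ g) {k i : ℕ} {σ : Finset (Set (Pt d))}
    (hσ : σ ∈ ((lazyTower hg).skeleton k).included (i + 1)) :
    ∃ C ∈ σ, C ∉ lazyPixels ε rep m₀ i := by
  obtain ⟨⟨⟨hne, hS, hx⟩, hk⟩, hmap⟩ := hσ
  by_contra! hold
  have hfix : ∀ C ∈ σ, g i C = C := fun C hC => by
    obtain ⟨h1, h2⟩ := hg i C (hold C hC)
    exact (eq_of_subset_of_mem_lazyPixels_succ (hS C hC) h2.1 h1).symm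
  refine hmap ⟨σ, ⟨⟨hne, hold, hx⟩, hk⟩, ?_⟩
  change σ.image (g i) = σ
  exact (Finset.image_congr (g := id) fun C hC => hfix C hC).trans Finset.image_id

variable [NeZero d]

theorem exists_dist_le_of_mem_newPixels (hε : 0 < ε) (hε' : ε ≤ 1 / 5) {α : ℝ} (hα : 0 < α)
    {C : Set (Pt d)} (hC : C ∈ newPixels ε rep α) :
    ∃ p ∈ P, lazyRadius ε rep p α = α ∧ ∀ x ∈ C, dist x p ≤ 9 / 8 * α := by
  obtain ⟨p, hp, hact, z, hz, rfl⟩ := hC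
  refine ⟨p, hp, hact, fun x hx => ?_⟩
  rw [hact] at hz
  have h1 := dist_pixelCenter_le (gridSide_pos hε α).le hx
  have h2 := gridSide_le (d := d) hε.le hα
  have h3 := dist_triangle x (pixelCenter (gridSide d ε α) z) p
  nlinarith

/-- The ball of radius `α` around a point that is active at scale `α` is covered by the pixels
added at that scale. -/
theorem mem_newPixels_of_dist_le (hε : 0 < ε) {α : ℝ} (hα : 0 < α) {b y : Pt d} (hb : b ∈ P)
    (hact : lazyRadius ε rep b α = α) (hy : dist y b ≤ α) :
    pixel (gridSide d ε α) (fun i => ⌊y i / gridSide d ε α⌋) ∈ newPixels ε rep α := by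
  refine ⟨b, hb, hact, _, ?_, rfl⟩
  have hs := gridSide_pos (d := d) hε α
  have h1 := dist_pixelCenter_le hs.le (mem_pixel_floor hs y)
  have h2 := gridSide_le (d := d) hε.le hα
  have h3 := dist_triangle_left (pixelCenter (gridSide d ε α) fun i => ⌊y i / gridSide d ε α⌋) b y
  rw [hact]
  nlinarith

/-- A pixel of a finer grid lies in the pixel of a coarser grid that contains its center. -/
theorem pixel_subset_of_center (hε : 0 < ε) {α α' : ℝ} (hα : 0 < α) (h : α ≤ α')
    (z : Fin d → ℤ) :
    pixel (gridSide d ε α) z ⊆ pixel (gridSide d ε α')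
      fun i => ⌊pixelCenter (gridSide d ε α) z i / gridSide d ε α'⌋ := by
  have hs := gridSide_pos (d := d) hε α
  have hs' := gridSide_pos (d := d) hε α'
  have hmem := mem_pixel_floor hs' (pixelCenter (gridSide d ε α) z)
  revert hmem
  generalize (fun i => ⌊pixelCenter (gridSide d ε α) z i / gridSide d ε α'⌋) = b
  obtain ⟨M, hM⟩ := exists_gridSide_eq_mul d ε hα h
  rw [hM]
  intro hmem
  refine pixel_subset_of_overlap hs fun i => ?_
  obtain ⟨h1, h2⟩ := hmem i
  simp only [pixelCenter] at h1 h2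
  constructor <;> nlinarith

/-- A pixel that meets a pixel added at scale `α` has itself been added at a scale larger than
`α / 2`. Indeed a pixel of an earlier scale, added around a point `p'`, lies in a pixel added at
scale `α`, since there is an active point at that scale near `p'`. -/
theorem exists_mem_newPixels_of_inter (hε : 0 < ε) (hε' : ε ≤ 1 / 5) (hδ : δ ≤ 1 / 40)
    {i : ℕ} {C C' : Set (Pt d)} (hC : C ∈ newPixels ε rep (scaleAt ε m₀ (i + 1)))
    (hC' : C' ∈ lazyPixels ε rep m₀ (i + 1)) (hCC' : (C ∩ C').Nonempty) :
    ∃ j, 1 ≤ j ∧ j ≤ i + 1 ∧ scaleAt ε m₀ (i + 1) < 2 * scaleAt ε m₀ j ∧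
      C' ∈ newPixels ε rep (scaleAt ε m₀ j) := by
  have hα := scaleAt_pos hε m₀ (i + 1)
  obtain ⟨x, hxC, hxC'⟩ := hCC'
  obtain ⟨p, hp, hact, hdist⟩ := exists_dist_le_of_mem_newPixels hε hε' hα hC
  rcases eq_singleton_or_mem_newPixels hC' with ⟨p', hp', rfl⟩ | ⟨j, hj, hji, hC'j⟩
  · -- a degenerate pixel is swallowed
    obtain rfl : x = p' := hxC'
    obtain ⟨b, hb, hbact, hyb⟩ := exists_active_near (x := x) (y := x) hε hδ hp hp' hα hact
      (hdist x hxC) (by rw [dist_self]; positivity) (by rw [dist_self]; positivity)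
    have hQ := mem_newPixels_of_dist_le hε hα hb hbact hyb
    have hs := gridSide_pos (d := d) hε (scaleAt ε m₀ (i + 1))
    have heq := eq_of_subset_of_mem_lazyPixels_succ hC' (Or.inr hQ)
      (Set.singleton_subset_iff.mpr (mem_pixel_floor hs x))
    exact absurd heq.ge (not_subsingleton_pixel hs _ x)
  · by_cases hlt : scaleAt ε m₀ (i + 1) < 2 * scaleAt ε m₀ j
    · exact ⟨j, hj, hji, hlt, hC'j⟩
    push Not at hlt
    have hαj := scaleAt_pos hε m₀ j
    obtain ⟨p', hp', -, hdist'⟩ := exists_dist_le_of_mem_newPixels hε hε' hαj hC'j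
    obtain ⟨z, rfl⟩ := exists_pixel_of_mem_newPixels hC'j
    have hc := hdist' _ (pixelCenter_mem_pixel (gridSide_pos hε _).le z)
    have hx := hdist' x hxC'
    obtain ⟨b, hb, hbact, hyb⟩ := exists_active_near hε hδ hp hp' hα hact
      (hdist x hxC) (by linarith) (hc.trans (by linarith))
    have hQ := mem_newPixels_of_dist_le hε hα hb hbact hyb
    have heq := eq_of_subset_of_mem_lazyPixels_succ hC' (Or.inr hQ)
      (pixel_subset_of_center hε hαj (scaleAt_mono hε m₀ hji) z)
    rw [← heq] at hQ
    exact ⟨i + 1, by omega, le_rfl, by linarith, hQ⟩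

/-- The larger pixels of the collection that meet a given pixel are distinguished by their
position relative to that pixel (below, above, or neither) in each coordinate: two of them with
the same position overlap, so that they are nested and hence equal. -/
theorem exists_injOn_position (hε : 0 < ε) {i j : ℕ} {C : Set (Pt d)}
    (hC : C ∈ newPixels ε rep (scaleAt ε m₀ j)) :
    ∃ f : Set (Pt d) → Fin d → Fin 3, Set.InjOn f {Q | Q ∈ lazyPixels ε rep m₀ (i + 1) ∧
      (Q ∩ C).Nonempty ∧ ∃ l, j ≤ l ∧ Q ∈ newPixels ε rep (scaleAt ε m₀ l)} := by
  classical
  obtain ⟨c, rfl⟩ := exists_pixel_of_mem_newPixels hC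
  set s := gridSide d ε (scaleAt ε m₀ j) with hsdef
  have hs : 0 < s := gridSide_pos hε _
  -- a step `l ≥ j` and an index `z` that present `Q` as a pixel of side `t Q`
  set q : Set (Pt d) → ℕ × (Fin d → ℤ) := fun Q =>
    if h : ∃ lz : ℕ × (Fin d → ℤ), j ≤ lz.1 ∧ Q = pixel (gridSide d ε (scaleAt ε m₀ lz.1)) lz.2
      then h.choose else 0 with hq
  set t : Set (Pt d) → ℝ := fun Q => gridSide d ε (scaleAt ε m₀ (q Q).1) with ht
  refine ⟨fun Q k => if t Q * ((q Q).2 k + 1) ≤ s * c k then 0 else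
    if s * (c k + 1) ≤ t Q * (q Q).2 k then 1 else 2, ?_⟩
  have hspec : ∀ Q l, j ≤ l → Q ∈ newPixels ε rep (scaleAt ε m₀ l) →
      j ≤ (q Q).1 ∧ Q = pixel (t Q) (q Q).2 := by
    intro Q l hjl hQ
    obtain ⟨z, hz⟩ := exists_pixel_of_mem_newPixels hQ
    have h : ∃ lz : ℕ × (Fin d → ℤ), j ≤ lz.1 ∧
      Q = pixel (gridSide d ε (scaleAt ε m₀ lz.1)) lz.2 := ⟨(l, z), hjl, hz⟩
    have := h.choose_spec
    simp only [ht, hq, dif_pos h]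
    exact this
  -- two pixels in the same position, the first one being the smaller one
  have key : ∀ Q₁ Q₂ : Set (Pt d), Q₁ ∈ lazyPixels ε rep m₀ (i + 1) →
      Q₂ ∈ lazyPixels ε rep m₀ (i + 1) → (Q₁ ∩ pixel s c).Nonempty → (Q₂ ∩ pixel s c).Nonempty →
      j ≤ (q Q₁).1 → (q Q₁).1 ≤ (q Q₂).1 → Q₁ = pixel (t Q₁) (q Q₁).2 →
      Q₂ = pixel (t Q₂) (q Q₂).2 →
      (∀ k, (if t Q₁ * ((q Q₁).2 k + 1) ≤ s * c k then (0 : Fin 3) else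
        if s * (c k + 1) ≤ t Q₁ * (q Q₁).2 k then 1 else 2) =
        if t Q₂ * ((q Q₂).2 k + 1) ≤ s * c k then 0 else
        if s * (c k + 1) ≤ t Q₂ * (q Q₂).2 k then 1 else 2) → Q₁ = Q₂ := by
    intro Q₁ Q₂ h₁ h₂ ⟨x₁, hx₁, hx₁c⟩ ⟨x₂, hx₂, hx₂c⟩ hj hle e₁ e₂ hpos
    refine eq_of_subset_of_mem_lazyPixels_succ h₁ h₂.1 ?_
    rw [e₁] at hx₁ ⊢
    rw [e₂] at hx₂ ⊢
    have ht₁ : 0 < t Q₁ := gridSide_pos hε _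
    have ht₂ : 0 < t Q₂ := gridSide_pos hε _
    obtain ⟨M₁, hM₁⟩ := exists_gridSide_eq_mul d ε (scaleAt_pos hε m₀ j) (scaleAt_mono hε m₀ hj)
    obtain ⟨M₂, hM₂⟩ := exists_gridSide_eq_mul d ε (scaleAt_pos hε m₀ j)
      (scaleAt_mono hε m₀ (hj.trans hle))
    obtain ⟨M, hM⟩ := exists_gridSide_eq_mul d ε (scaleAt_pos hε m₀ _) (scaleAt_mono hε m₀ hle)
    change t Q₁ = s * M₁ at hM₁
    change t Q₂ = s * M₂ at hM₂
    change t Q₂ = t Q₁ * M at hM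
    rw [hM]
    refine pixel_subset_of_overlap ht₁ fun k => ?_
    rw [← hM]
    have hk := hpos k
    have tri₁ := interval_trichotomy hs M₁ (c k) ((q Q₁).2 k)
    have tri₂ := interval_trichotomy hs M₂ (c k) ((q Q₂).2 k)
    rw [← hM₁] at tri₁
    rw [← hM₂] at tri₂
    have := hx₁ k
    have := hx₂ k
    have := hx₁c k
    have := hx₂c k
    generalize t Q₁ = t₁ at *
    generalize t Q₂ = t₂ at *
    split_ifs at hk
    all_goals first
      | exact absurd hk (by decide)
      | (constructor <;> nlinarith)
      | (have r₁ := (tri₁.resolve_left ‹_›).resolve_left ‹_›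
         have r₂ := (tri₂.resolve_left ‹_›).resolve_left ‹_›
         constructor <;> nlinarith)
  intro Q₁ ⟨h₁, hx₁, l₁, hl₁, hn₁⟩ Q₂ ⟨h₂, hx₂, l₂, hl₂, hn₂⟩ hpos
  obtain ⟨hj₁, e₁⟩ := hspec Q₁ l₁ hl₁ hn₁
  obtain ⟨hj₂, e₂⟩ := hspec Q₂ l₂ hl₂ hn₂
  rcases le_total (q Q₁).1 (q Q₂).1 with hle | hle
  · exact key Q₁ Q₂ h₁ h₂ hx₁ hx₂ hj₁ hle e₁ e₂ (fun k => congrFun hpos k)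
  · exact (key Q₂ Q₁ h₂ h₁ hx₂ hx₁ hj₂ hle e₂ e₁ (fun k => (congrFun hpos k).symm)).symm

end Vertices

/-! ### Counting -/

section Counting

/-- There are at most `M ^ k` subsets of `S` with at most `k + 1` elements that contain a given
element `v`, if `S` injects into a type with `M` elements. -/
theorem exists_finset_of_injOn {V T : Type*} [Fintype T] {S : Set V} {f : V → T}
    (hf : Set.InjOn f S) {v : V} (hv : v ∈ S) (k : ℕ) :
    ∃ F : Finset (Finset V), F.card ≤ Fintype.card T ^ k ∧
      ∀ σ : Finset V, v ∈ σ → σ.card ≤ k + 1 → (∀ w ∈ σ, w ∈ S) → σ ∈ F := by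
  classical
  have : Finite S := Finite.of_injective (fun x : S => f x) fun x y h =>
    Subtype.ext (hf x.2 y.2 h)
  have : Fintype S := Fintype.ofFinite S
  have hS : Fintype.card S ≤ Fintype.card T :=
    Fintype.card_le_of_injective (fun x : S => f x) fun x y h => Subtype.ext (hf x.2 y.2 h)
  refine ⟨Finset.univ.image fun u : Fin k → S => insert v (Finset.univ.image fun i => (u i : V)),
    ?_, fun σ hvσ hσ hσS => ?_⟩
  · refine Finset.card_image_le.trans ?_
    rw [Finset.card_univ, Fintype.card_fun, Fintype.card_fin]
    exact Nat.pow_le_pow_left hS k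
  · have hcard : Fintype.card (σ.erase v) ≤ Fintype.card (Fin k) := by
      rw [Fintype.card_coe, Finset.card_erase_of_mem hvσ, Fintype.card_fin]
      omega
    obtain ⟨e⟩ := Function.Embedding.nonempty_of_card_le hcard
    have hmem : ∀ w : σ.erase v, (w : V) ∈ S := fun w => hσS w (Finset.mem_of_mem_erase w.2)
    refine Finset.mem_image.mpr
      ⟨Function.extend e (fun w => ⟨w, hmem w⟩) fun _ => ⟨v, hv⟩, Finset.mem_univ _, ?_⟩
    ext w
    simp only [Finset.mem_insert, Finset.mem_image, Finset.mem_univ, true_and]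
    constructor
    · rintro (rfl | ⟨i, rfl⟩)
      · exact hvσ
      · by_cases h : ∃ x, e x = i
        · obtain ⟨x, rfl⟩ := h
          rw [e.injective.extend_apply]
          exact Finset.mem_of_mem_erase x.2
        · rw [Function.extend_apply' _ _ _ h]
          exact hvσ
    · intro hw
      by_cases hwv : w = v
      · exact Or.inl hwv
      · refine Or.inr ⟨e ⟨w, Finset.mem_erase.mpr ⟨hwv, hw⟩⟩, ?_⟩
        rw [e.injective.extend_apply]

theorem exists_finset_scaleAt_mem_Icc {ε K a b : ℝ} (hε : 0 < ε) (hK : 1 ≤ K) (hab : b ≤ K * a)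
    (m₀ : ℤ) :
    ∃ J : Finset ℕ, (J.card : ℝ) ≤ (K - 1) / ε + 1 ∧
      ∀ j, scaleAt ε m₀ j ∈ Set.Icc a b → j ∈ J := by
  have h0 : 0 ≤ (K - 1) / ε := div_nonneg (by linarith) hε.le
  by_cases h : ∃ j, scaleAt ε m₀ j ∈ Set.Icc a b
  · classical
    refine ⟨Finset.Icc (Nat.find h) (Nat.find h + ⌊(K - 1) / ε⌋₊), ?_, fun j hj => ?_⟩
    · rw [Nat.card_Icc]
      have := Nat.floor_le h0
      have e : Nat.find h + ⌊(K - 1) / ε⌋₊ + 1 - Nat.find h = ⌊(K - 1) / ε⌋₊ + 1 := by omega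
      rw [e]
      push_cast
      linarith
    · have hle := Nat.find_min' h hj
      obtain ⟨t, rfl⟩ := Nat.exists_eq_add_of_le hle
      refine Finset.mem_Icc.mpr ⟨hle, Nat.add_le_add_left (Nat.le_floor ?_) _⟩
      refine le_div_of_scaleAt_add_le hε (hj.2.trans (hab.trans ?_))
      have := (Nat.find_spec h).1
      gcongr
  · exact ⟨∅, by simpa using by linarith, fun j hj => absurd ⟨j, hj⟩ h⟩

/-- Bound on the number of pixels whose center lies in a ball. -/
theorem exists_finset_dist_pixelCenter_le {d : ℕ} {s ρ : ℝ} (hs : 0 < s) (hρ : 0 ≤ ρ) (p : Pt d) :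
    ∃ Z : Finset (Fin d → ℤ), (Z.card : ℝ) ≤ (2 * ρ / s + 1) ^ d ∧
      ∀ z, dist (pixelCenter s z) p ≤ ρ → z ∈ Z := by
  refine ⟨Fintype.piFinset fun i =>
    Finset.Icc ⌈(p i - ρ) / s - 1 / 2⌉ ⌊(p i + ρ) / s - 1 / 2⌋, ?_, fun z hz => ?_⟩
  · rw [Fintype.card_piFinset]
    push_cast
    have hcard : ∀ i ∈ Finset.univ,
        ((Finset.Icc ⌈(p i - ρ) / s - 1 / 2⌉ ⌊(p i + ρ) / s - 1 / 2⌋).card : ℝ) ≤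
          2 * ρ / s + 1 := by
      intro i _
      have h1 := Int.le_ceil ((p i - ρ) / s - 1 / 2)
      have h2 := Int.floor_le ((p i + ρ) / s - 1 / 2)
      have h3 : (p i + ρ) / s - (p i - ρ) / s = 2 * ρ / s := by ring
      rw [Int.card_Icc, ← Int.cast_natCast, Int.toNat_eq_max]
      push_cast
      refine max_le ?_ (by positivity)
      linarith
    simpa using Finset.prod_le_prod (fun i _ => Nat.cast_nonneg _) hcard
  · refine Fintype.mem_piFinset.mpr fun i => ?_
    have h1 := PiLp.norm_apply_le (pixelCenter s z - p) i
    rw [← dist_eq_norm] at h1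
    have h2 : |s * (z i + 1 / 2) - p i| ≤ ρ := by
      simpa [pixelCenter, Real.norm_eq_abs] using h1.trans hz
    obtain ⟨h3, h4⟩ := abs_le.mp h2
    refine Finset.mem_Icc.mpr ⟨Int.ceil_le.mpr ?_, Int.le_floor.mpr ?_⟩
    · rw [sub_le_iff_le_add, div_le_iff₀ hs]
      linarith
    · rw [le_sub_iff_add_le, le_div_iff₀ hs]
      linarith

variable {d : ℕ} {P : Finset (Pt d)} {δ ε : ℝ} {W : WSPD P δ} {m₀ : ℤ}

/-- Each pair makes its two representatives active during `O(1 / ε)` scales. -/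
theorem exists_finset_mem_pairInterval (hε : 0 < ε) (hε' : ε ≤ 1 / 5) (rep : Reps W) (m₀ : ℤ)
    (w : Finset (Pt d) × Finset (Pt d)) :
    ∃ J : Finset ℕ, (J.card : ℝ) ≤ 92 / ε + 1 ∧
      ∀ j, scaleAt ε m₀ j ∈ pairInterval ε rep w → j ∈ J := by
  have hD : 0 ≤ repDist rep w := dist_nonneg
  rcases hD.eq_or_lt with hD | hD
  · refine ⟨∅, by simpa using by positivity, fun j hj => ?_⟩
    rw [pairInterval, ← hD, zero_div, mul_zero, enlarged_zero hε] at hj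
    exact absurd hj (scaleAt_pos hε m₀ j).ne'
  · -- the ratio of the endpoints is at most `64 * (1 + ε) ^ 2 ≤ 93`
    obtain ⟨J, hJ, hmem⟩ := exists_finset_scaleAt_mem_Icc (K := 93)
      (a := repDist rep w / 8 / (1 + ε)) (b := (1 + ε) * (8 * repDist rep w)) hε (by norm_num)
      (by
        rw [mul_div_assoc', le_div_iff₀ (by positivity)]
        have : (1 + ε) * (1 + ε) ≤ 36 / 25 := by nlinarith
        nlinarith) m₀
    refine ⟨J, by norm_num at hJ; exact hJ, fun j hj => hmem j ?_⟩
    exact enlarged_subset hε (by positivity) (by positivity) hj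

/-- In dimension `0` there is only one nonempty pixel, and no simplex is included after the first
step. -/
theorem exists_size_skeleton_eq_of_dim_zero {P : Finset (Pt 0)} {W : WSPD P δ} {rep : Reps W}
    {g : ℕ → Set (Pt 0) → Set (Pt 0)} (hg : IsPixelMap ε rep m₀ g) (k : ℕ) :
    ∃ N : ℕ, ((lazyTower hg).skeleton k).size = N ∧ N ≤ P.card := by
  classical
  set S : Set (ℕ × Finset (Set (Pt 0))) :=
    {x | x.2 ∈ ((lazyTower hg).skeleton k).included x.1} with hS
  let S₀ : Finset (ℕ × Finset (Set (Pt 0))) := P.image fun p => (0, {{p}})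
  have hsub : S ⊆ ↑S₀ := by
    rintro ⟨i, σ⟩ hσ
    rcases i with - | i
    · obtain ⟨p, hp, rfl⟩ := Finset.mem_image.mp (mem_image_of_mem_included_zero hg hσ)
      exact Finset.mem_image.mpr ⟨p, hp, rfl⟩
    · exfalso
      obtain ⟨C, hCσ, hC⟩ := exists_notMem_lazyPixels_of_mem_included hg hσ
      obtain ⟨⟨⟨-, hS, x, hx⟩, -⟩, -⟩ := hσ
      simp only [Set.mem_iInter] at hx
      obtain ⟨p, hp⟩ : ∃ p, p ∈ P := by
        rcases eq_singleton_or_mem_newPixels (hS C hCσ) with ⟨p, hp, -⟩ | ⟨j, -, -, p, hp, -⟩ <;>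
          exact ⟨p, hp⟩
      have huniv : ∀ D : Set (Pt 0), D.Nonempty → D = Set.univ := fun D hD =>
        Subsingleton.eq_univ_of_nonempty hD
      have hmem : ∀ i, Set.univ ∈ lazyPixels ε rep m₀ i := by
        intro i
        induction i with
        | zero => exact ⟨p, hp, (huniv {p} (Set.singleton_nonempty p)).symm⟩
        | succ i ih =>
          have h := hg i _ ih
          rw [Set.univ_subset_iff] at h
          exact h.1 ▸ h.2
      rw [huniv C ⟨x, hx C hCσ⟩] at hC
      exact hC (hmem i)
  have hfin : S.Finite := S₀.finite_toSet.subset hsub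
  refine ⟨S.ncard, (hfin.cast_ncard_eq).symm, ?_⟩
  have := Set.ncard_le_ncard hsub S₀.finite_toSet
  rw [Set.ncard_coe_finset] at this
  exact this.trans Finset.card_image_le

variable [NeZero d]

/-- The total number of pixels added to the tower, over all scales. -/
theorem exists_finset_newPixels (hε : 0 < ε) (hε' : ε ≤ 1 / 5) (rep : Reps W) (m₀ : ℤ) :
    ∃ B : Finset (ℕ × Set (Pt d)),
      (B.card : ℝ) ≤ W.pairs.card * (2 * ((92 / ε + 1) * (18 * √(d : ℝ) / ε) ^ d)) ∧
      (∀ b ∈ B, b.2 ∈ newPixels ε rep (scaleAt ε m₀ b.1)) ∧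
      ∀ j C, C ∈ newPixels ε rep (scaleAt ε m₀ j) → (j, C) ∈ B := by
  classical
  choose J hJcard hJ using exists_finset_mem_pairInterval hε hε' rep m₀
  have hZ : ∀ (j : ℕ) (p : Pt d), ∃ Z : Finset (Fin d → ℤ),
      (Z.card : ℝ) ≤ (18 * √(d : ℝ) / ε) ^ d ∧
      ∀ z, dist (pixelCenter (gridSide d ε (scaleAt ε m₀ j)) z) p ≤
        (1 + ε / 2) * scaleAt ε m₀ j → z ∈ Z := by
    intro j p
    have hα := scaleAt_pos hε m₀ j
    have hs := gridSide_pos (d := d) hε (scaleAt ε m₀ j)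
    obtain ⟨Z, hZcard, hZ⟩ := exists_finset_dist_pixelCenter_le
      (ρ := (1 + ε / 2) * scaleAt ε m₀ j) hs (by positivity) p
    refine ⟨Z, hZcard.trans (pow_le_pow_left₀ (by positivity) ?_ d), hZ⟩
    have h1 := lt_gridSide (d := d) hε (scaleAt ε m₀ j)
    have hd : (1 : ℝ) ≤ √(d : ℝ) := by
      rw [Real.one_le_sqrt]
      exact_mod_cast Nat.pos_of_ne_zero (NeZero.ne d)
    generalize scaleAt ε m₀ j = α at *
    generalize gridSide d ε α = s at *
    have h2 : α / s ≤ 8 * √(d : ℝ) / ε := by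
      rw [div_le_div_iff₀ hs hε]
      linarith
    have h3 : 5 ≤ √(d : ℝ) / ε := by
      rw [le_div_iff₀ hε]
      linarith
    have h4 : 2 * ((1 + ε / 2) * α) / s = (2 + ε) * (α / s) := by ring
    have h5 : (2 + ε) * (α / s) ≤ 11 / 5 * (8 * √(d : ℝ) / ε) := by
      gcongr
      linarith
    have h6 : 11 / 5 * (8 * √(d : ℝ) / ε) = 88 / 5 * (√(d : ℝ) / ε) := by ring
    have h7 : 18 * √(d : ℝ) / ε = 18 * (√(d : ℝ) / ε) := by ring
    rw [h4, h7]
    linarith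
  choose Z hZcard hZ using hZ
  let B₀ : Finset (ℕ × Set (Pt d)) := W.pairs.biUnion fun w =>
    ({rep.left w, rep.right w} : Finset (Pt d)).biUnion fun p => (J w).biUnion fun j =>
      (Z j p).image fun z => (j, pixel (gridSide d ε (scaleAt ε m₀ j)) z)
  have hB₀ : (B₀.card : ℝ) ≤ W.pairs.card * (2 * ((92 / ε + 1) * (18 * √(d : ℝ) / ε) ^ d)) := by
    have h1 : B₀.card ≤ ∑ w ∈ W.pairs, ∑ p ∈ ({rep.left w, rep.right w} : Finset (Pt d)),
        ∑ j ∈ J w, (Z j p).card :=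
      Finset.card_biUnion_le.trans <| Finset.sum_le_sum fun w _ =>
        Finset.card_biUnion_le.trans <| Finset.sum_le_sum fun p _ =>
          Finset.card_biUnion_le.trans <| Finset.sum_le_sum fun j _ => Finset.card_image_le
    refine (Nat.cast_le.mpr h1).trans ?_
    push_cast
    rw [← nsmul_eq_mul]
    refine Finset.sum_le_card_nsmul _ _ _ fun w _ => ?_
    have h2 : ∀ p, ∑ j ∈ J w, ((Z j p).card : ℝ) ≤
        (92 / ε + 1) * (18 * √(d : ℝ) / ε) ^ d := by
      intro p
      refine (Finset.sum_le_card_nsmul _ _ _ fun j _ => hZcard j p).trans ?_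
      rw [nsmul_eq_mul]
      gcongr
      exact hJcard w
    refine (Finset.sum_le_card_nsmul _ _ _ fun p _ => h2 p).trans ?_
    rw [nsmul_eq_mul]
    gcongr
    exact_mod_cast Finset.card_le_two
  refine ⟨B₀.filter fun b => b.2 ∈ newPixels ε rep (scaleAt ε m₀ b.1),
    (Nat.cast_le.mpr (Finset.card_filter_le _ _)).trans hB₀,
    fun b hb => (Finset.mem_filter.mp hb).2, fun j C hC => Finset.mem_filter.mpr ⟨?_, hC⟩⟩
  obtain ⟨p, -, hact, z, hz, rfl⟩ := hC
  obtain ⟨w, hw, hp, hj⟩ := mem_activeScales_of_lazyRadius_eq (scaleAt_pos hε m₀ j) hact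
  rw [hact] at hz
  simp only [B₀, Finset.mem_biUnion, Finset.mem_image]
  exact ⟨w, hw, p, by simpa using hp, j, hJ w j hj, z, hZ j p z hz, rfl⟩

/-- The size of the skeleton in terms of the number of pixels. Each simplex included after the
first step is charged to a vertex `C` of it that is added earliest, together with the number of
steps since then. All its vertices touch `C`. -/
theorem exists_size_skeleton_eq (hε : 0 < ε) (hε' : ε ≤ 1 / 5) (hδ : δ ≤ 1 / 40) {rep : Reps W}
    {g : ℕ → Set (Pt d) → Set (Pt d)} (hg : IsPixelMap ε rep m₀ g) (k : ℕ) :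
    ∃ N : ℕ, ((lazyTower hg).skeleton k).size = N ∧
      (N : ℝ) ≤ P.card + W.pairs.card * (2 * ((92 / ε + 1) * (18 * √(d : ℝ) / ε) ^ d)) *
        ((1 / ε + 1) * (3 ^ d) ^ k) := by
  classical
  obtain ⟨B, hBcard, hBnew, hB⟩ := exists_finset_newPixels hε hε' rep m₀
  have hF : ∀ b : ℕ × Set (Pt d), ∀ i : ℕ, ∃ F : Finset (Finset (Set (Pt d))),
      F.card ≤ (3 ^ d) ^ k ∧ (b ∈ B → ∀ σ : Finset (Set (Pt d)), b.2 ∈ σ → σ.card ≤ k + 1 →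
        (∀ Q ∈ σ, Q ∈ lazyPixels ε rep m₀ (i + 1) ∧ (Q ∩ b.2).Nonempty ∧
          ∃ l, b.1 ≤ l ∧ Q ∈ newPixels ε rep (scaleAt ε m₀ l)) → σ ∈ F) := by
    intro b i
    by_cases hb : b ∈ B ∧ b.2 ∈ lazyPixels ε rep m₀ (i + 1)
    · obtain ⟨hb, hbi⟩ := hb
      obtain ⟨f, hf⟩ := exists_injOn_position (i := i) hε (hBnew b hb)
      have hne : (b.2 ∩ b.2).Nonempty := by
        obtain ⟨z, hz⟩ := exists_pixel_of_mem_newPixels (hBnew b hb)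
        rw [Set.inter_self, hz]
        exact ⟨_, pixelCenter_mem_pixel (gridSide_pos hε _).le z⟩
      obtain ⟨F, hFcard, hF⟩ := exists_finset_of_injOn hf
        (v := b.2) ⟨hbi, hne, b.1, le_rfl, hBnew b hb⟩ k
      refine ⟨F, by simpa using hFcard, fun _ => hF⟩
    · exact ⟨∅, by simp, fun hb' σ hbσ _ hσ => absurd ⟨hb', (hσ _ hbσ).1⟩ hb⟩
  choose F hFcard hF using hF
  set S : Set (ℕ × Finset (Set (Pt d))) :=
    {x | x.2 ∈ ((lazyTower hg).skeleton k).included x.1} with hS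
  let S₀ : Finset (ℕ × Finset (Set (Pt d))) := P.image fun p => (0, {{p}})
  let S₁ : Finset (ℕ × Finset (Set (Pt d))) := B.biUnion fun b =>
    (Finset.range (⌊1 / ε⌋₊ + 1)).biUnion fun t =>
      (F b (b.1 + t - 1)).image fun σ => (b.1 + t, σ)
  have hsub : S ⊆ ↑(S₀ ∪ S₁) := by
    rintro ⟨i, σ⟩ hσ
    rw [Finset.coe_union]
    rcases i with - | i
    · left
      obtain ⟨p, hp, rfl⟩ := Finset.mem_image.mp (mem_image_of_mem_included_zero hg hσ)
      exact Finset.mem_image.mpr ⟨p, hp, rfl⟩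
    · right
      obtain ⟨C, hCσ, hC⟩ := exists_notMem_lazyPixels_of_mem_included hg hσ
      obtain ⟨⟨⟨hne, hS, x, hx⟩, hk⟩, -⟩ := hσ
      replace hC := (hS C hCσ).1.resolve_left hC
      simp only [Set.mem_iInter] at hx
      have hbirth : ∀ Q ∈ σ, ∃ j, 1 ≤ j ∧ j ≤ i + 1 ∧
          scaleAt ε m₀ (i + 1) < 2 * scaleAt ε m₀ j ∧ Q ∈ newPixels ε rep (scaleAt ε m₀ j) :=
        fun Q hQ => exists_mem_newPixels_of_inter hε hε' hδ hC (hS Q hQ) ⟨x, hx C hCσ, hx Q hQ⟩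
      choose! j hj1 hji hlt hnew using hbirth
      obtain ⟨C', hC', hmin⟩ := σ.exists_min_image j hne
      simp only [S₁, Finset.coe_biUnion, Set.mem_iUnion, Finset.mem_coe, exists_prop,
        Finset.mem_image, Finset.mem_range]
      obtain ⟨t, ht⟩ := Nat.exists_eq_add_of_le (hji C' hC')
      refine ⟨(j C', C'), hB _ _ (hnew C' hC'), t, Nat.lt_succ_of_le (Nat.le_floor ?_), σ, ?_, ?_⟩
      · have h := hlt C' hC'
        rw [ht] at h
        have := le_div_of_scaleAt_add_le hε h.le
        norm_num at this ⊢
        exact this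
      · have e : j C' + t - 1 = i := by omega
        refine hF _ _ (hB _ _ (hnew C' hC')) σ hC' hk fun Q hQ => ?_
        rw [e]
        exact ⟨hS Q hQ, ⟨x, hx Q hQ, hx C' hC'⟩, j Q, hmin Q hQ, hnew Q hQ⟩
      · exact Prod.ext ht.symm rfl
  have hfin : S.Finite := (S₀ ∪ S₁).finite_toSet.subset hsub
  refine ⟨S.ncard, (hfin.cast_ncard_eq).symm, ?_⟩
  have h1 : S.ncard ≤ S₀.card + S₁.card := by
    have := Set.ncard_le_ncard hsub (S₀ ∪ S₁).finite_toSet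
    rw [Set.ncard_coe_finset] at this
    exact this.trans (Finset.card_union_le _ _)
  have h2 : S₁.card ≤ B.card * ((⌊1 / ε⌋₊ + 1) * (3 ^ d) ^ k) := by
    refine Finset.card_biUnion_le_card_mul _ _ _ fun b _ => ?_
    refine (Finset.card_biUnion_le_card_mul _ _ ((3 ^ d) ^ k) fun t _ =>
      Finset.card_image_le.trans (hFcard _ _)).trans ?_
    rw [Finset.card_range]
  have h3 : (S.ncard : ℝ) ≤ P.card + B.card * ((⌊1 / ε⌋₊ + 1) * (3 ^ d) ^ k) := by
    exact_mod_cast h1.trans (Nat.add_le_add Finset.card_image_le h2)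
  refine h3.trans ?_
  have h4 : (⌊1 / ε⌋₊ : ℝ) ≤ 1 / ε := Nat.floor_le (by positivity)
  gcongr

end Counting

/-! ### The bounds -/

theorem exists_wspd_card_le (d : ℕ) (P : Finset (Pt d)) {ε : ℝ} (hε : 0 < ε) (hε' : ε ≤ 1 / 5) :
    ∃ W : WSPD P (ε / 8), (W.pairs.card : ℝ) ≤ P.card * (1 / ε) ^ (8 * d) := by
  rcases Nat.eq_zero_or_pos d with rfl | hd
  · refine ⟨⟨∅, by simp, by simp, by simp, fun p _ q _ h => absurd (Subsingleton.elim p q) h⟩, ?_⟩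
    simp
  · obtain ⟨W, hW⟩ := exists_wspd P (show 0 < ε / 8 by positivity) (by linarith)
    refine ⟨W, hW.trans ?_⟩
    have h5 : 5 ≤ 1 / ε := by rw [le_div_iff₀ hε]; linarith
    have e1 : 7 / (ε / 8) = 56 * (1 / ε) := by field_simp; norm_num
    have e2 : 15 / (ε / 8) = 120 * (1 / ε) := by field_simp; norm_num
    rw [e1, e2]
    generalize 1 / ε = t at *
    have h3 : 125 ≤ t ^ 3 := by
      calc (125 : ℝ) = 5 ^ 3 := by norm_num
        _ ≤ t ^ 3 := by gcongr
    have h4 : 120 * t ≤ t ^ 4 := by nlinarith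
    have h4' : 56 * t + 1 ≤ t ^ 4 := by nlinarith
    gcongr
    calc (56 * t + 1) * (120 * t) ^ d ≤ t ^ 4 * (t ^ 4) ^ d := by gcongr
      _ = t ^ (4 + 4 * d) := by rw [← pow_mul, ← pow_add]
      _ ≤ t ^ (8 * d) := pow_le_pow_right₀ (by linarith) (by omega)

theorem exists_size_skeleton_le (c d k : ℕ) (P : Finset (Pt d)) {ε : ℝ} (hε : 0 < ε)
    (hε' : ε ≤ 1 / 5) (W : WSPD P (ε / 8))
    (hW : (W.pairs.card : ℝ) ≤ P.card * (1 / ε) ^ (c * d)) (rep : Reps W) (m₀ : ℤ)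
    (g : ℕ → Set (Pt d) → Set (Pt d)) (hg : IsPixelMap ε rep m₀ g) :
    ∃ N : ℕ, ((lazyTower hg).skeleton k).size = N ∧
      (N : ℝ) ≤ P.card * (1 / ε) ^ ((c + 11) * d) *
        (2 : ℝ) ^ (((c + 11 : ℕ) : ℝ) * (d * Real.logb 2 d + d * k)) := by
  rcases Nat.eq_zero_or_pos d with rfl | hd
  · obtain ⟨N, hN, hle⟩ := exists_size_skeleton_eq_of_dim_zero hg k
    exact ⟨N, hN, by simpa using hle⟩
  have : NeZero d := ⟨hd.ne'⟩
  obtain ⟨N, hN, hle⟩ := exists_size_skeleton_eq hε hε' (by linarith) hg k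
  refine ⟨N, hN, hle.trans ?_⟩
  have h5 : 5 ≤ 1 / ε := by rw [le_div_iff₀ hε]; linarith
  have hd1 : (1 : ℝ) ≤ d := by exact_mod_cast hd
  have hlog : 0 ≤ Real.logb 2 d := Real.logb_nonneg (by norm_num) hd1
  have hexp : (d : ℝ) ^ d * (3 ^ d) ^ k ≤
      (2 : ℝ) ^ (((c + 11 : ℕ) : ℝ) * (d * Real.logb 2 d + d * k)) := by
    have h1 : (d : ℝ) ^ d = (2 : ℝ) ^ (d * Real.logb 2 d) := by
      rw [mul_comm, Real.rpow_mul (by norm_num), Real.rpow_logb (by norm_num) (by norm_num)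
        (by linarith), Real.rpow_natCast]
    have h2 : ((3 : ℝ) ^ d) ^ k ≤ (2 : ℝ) ^ (2 * ((d : ℝ) * k)) := by
      rw [← pow_mul, Real.rpow_mul (by norm_num)]
      norm_cast
      gcongr
      norm_num
    rw [h1]
    calc (2 : ℝ) ^ (d * Real.logb 2 d) * (3 ^ d) ^ k
        ≤ (2 : ℝ) ^ (d * Real.logb 2 d) * (2 : ℝ) ^ (2 * ((d : ℝ) * k)) := by gcongr
      _ = (2 : ℝ) ^ (d * Real.logb 2 d + 2 * ((d : ℝ) * k)) :=
        (Real.rpow_add (by norm_num) _ _).symm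
      _ ≤ _ := by
        refine Real.rpow_le_rpow_of_exponent_le (by norm_num) ?_
        have h3 : (11 : ℝ) ≤ ((c + 11 : ℕ) : ℝ) := by
          push_cast
          linarith [Nat.cast_nonneg (α := ℝ) c]
        have h4 : 0 ≤ (d : ℝ) * Real.logb 2 d + d * k := by positivity
        have h5 : 0 ≤ (d : ℝ) * Real.logb 2 d := by positivity
        have h6 : 0 ≤ (d : ℝ) * k := by positivity
        nlinarith
  have hsqrt : √(d : ℝ) ≤ d := Real.sqrt_le_iff.mpr ⟨by linarith, by nlinarith⟩
  have e1 : 92 / ε = 92 * (1 / ε) := by ring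
  have e2 : 18 * √(d : ℝ) / ε = 18 * (1 / ε) * √(d : ℝ) := by ring
  rw [e1, e2]
  generalize 1 / ε = t at *
  have ht1 : 1 ≤ t := by linarith
  have h3 : 125 ≤ t ^ 3 := by
    calc (125 : ℝ) = 5 ^ 3 := by norm_num
      _ ≤ t ^ 3 := by gcongr
  have hX : 1 ≤ (d : ℝ) ^ d * (3 ^ d) ^ k :=
    one_le_mul_of_one_le_of_one_le (one_le_pow₀ hd1) (one_le_pow₀ (one_le_pow₀ (by norm_num)))
  have hstep : 2 * ((92 * t + 1) * (18 * t * √(d : ℝ)) ^ d) * ((t + 1) * (3 ^ d) ^ k) ≤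
      t ^ (7 + 3 * d) * ((d : ℝ) ^ d * (3 ^ d) ^ k) := by
    have b1 : 92 * t + 1 ≤ t ^ 4 := by nlinarith
    have b2 : t + 1 ≤ t ^ 2 := by nlinarith
    have b3 : 18 * t ≤ t ^ 3 := by nlinarith
    calc 2 * ((92 * t + 1) * (18 * t * √(d : ℝ)) ^ d) * ((t + 1) * (3 ^ d) ^ k)
        ≤ t * (t ^ 4 * (t ^ 3 * (d : ℝ)) ^ d) * (t ^ 2 * (3 ^ d) ^ k) := by
          gcongr
          linarith
      _ = t ^ (7 + 3 * d) * ((d : ℝ) ^ d * (3 ^ d) ^ k) := by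
          rw [mul_pow, ← pow_mul]
          ring
  calc (P.card : ℝ) + W.pairs.card * (2 * ((92 * t + 1) * (18 * t * √(d : ℝ)) ^ d)) *
        ((t + 1) * (3 ^ d) ^ k)
      = P.card + W.pairs.card * (2 * ((92 * t + 1) * (18 * t * √(d : ℝ)) ^ d) *
        ((t + 1) * (3 ^ d) ^ k)) := by ring
    _ ≤ P.card * (t ^ (c * d + (7 + 3 * d)) * ((d : ℝ) ^ d * (3 ^ d) ^ k)) +
        (P.card * t ^ (c * d)) * (t ^ (7 + 3 * d) * ((d : ℝ) ^ d * (3 ^ d) ^ k)) := by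
      gcongr
      exact le_mul_of_one_le_right (by positivity)
        (one_le_mul_of_one_le_of_one_le (one_le_pow₀ ht1) hX)
    _ = 2 * (P.card * t ^ (c * d + (7 + 3 * d)) * ((d : ℝ) ^ d * (3 ^ d) ^ k)) := by
      rw [pow_add]
      ring
    _ ≤ t * (P.card * t ^ (c * d + (7 + 3 * d)) * ((d : ℝ) ^ d * (3 ^ d) ^ k)) := by
      gcongr
      linarith
    _ = P.card * t ^ (c * d + (8 + 3 * d)) * ((d : ℝ) ^ d * (3 ^ d) ^ k) := by ring
    _ ≤ P.card * t ^ ((c + 11) * d) *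
        (2 : ℝ) ^ (((c + 11 : ℕ) : ℝ) * (d * Real.logb 2 d + d * k)) := by
      gcongr
      nlinarith

end LazyCech

theorem mainTheorem2 :
    (∃ c₀ : ℕ, ∀ (d : ℕ) (P : Finset (LazyCech.Pt d)) (ε : ℝ), 0 < ε → ε ≤ 1 / 5 →
      ∃ W : LazyCech.WSPD P (ε / 8), (W.pairs.card : ℝ) ≤ P.card * (1 / ε) ^ (c₀ * d)) ∧
    ∀ c : ℕ, ∃ C : ℕ, ∀ (d k : ℕ) (P : Finset (LazyCech.Pt d)) (ε : ℝ), 0 < ε → ε ≤ 1 / 5 →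
      ∀ W : LazyCech.WSPD P (ε / 8), (W.pairs.card : ℝ) ≤ P.card * (1 / ε) ^ (c * d) →
      ∀ (rep : LazyCech.Reps W) (m₀ : ℤ) (g : ℕ → Set (LazyCech.Pt d) → Set (LazyCech.Pt d))
        (hg : LazyCech.IsPixelMap ε rep m₀ g),
        ∃ N : ℕ, ((LazyCech.lazyTower hg).skeleton k).size = N ∧
          (N : ℝ) ≤ P.card * (1 / ε) ^ (C * d) *
            (2 : ℝ) ^ ((C : ℝ) * (d * Real.logb 2 d + d * k)) := by
  refine ⟨⟨8, fun d P ε hε hε' => LazyCech.exists_wspd_card_le d P hε hε'⟩, fun c => ⟨c + 11, ?_⟩⟩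
  intro d k P ε hε hε' W hW rep m₀ g hg
  exact LazyCech.exists_size_skeleton_le c d k P hε hε' W hW rep m₀ g hg
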